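/- Let $(R,\mathfrak m)$ be a regular local domain with $\dim R\ge 2$ and field of fractions $K$; all local rings below are subrings of $K$. For local rings $A, B\subseteq K$, say that $B$ *dominates* $A$ if $A\subseteq B$ and $\mathfrak m_B\cap A=\mathfrak m_A$. A *local quadratic transform* of $A$ is a local ring $B$ on $\operatorname{Proj}A[\mathfrak m_A t]$, that is, $B=A[\mathfrak m_A/x]_P$ for some nonzero $x\in\mathfrak m_A$ and some prime ideal $P$, that dominates $A$. An *infinitely near point* to $R$ is a regular local ring $T$ with $\dim T\ge 2$ that dominates $R$ and is obtained from $R$ by a finite (possibly empty) sequence of local quadratic transforms. For an ideal $I$ of $R$, an infinitely near point $T$ is a *base point* of $I$ if the transform $I^T=a^{-1}IT$, where $aT$ is the smallest principal ideal of $T$ containing $IT$, is a proper ideal of $T$; and $I$ is *finitely supported* if it has only finitely many base points. For a regular local ring $T$ with field of fractions $K$, let $\operatorname{ord}_T$ denote the order function defined by the powers of $\mathfrak m_T$, and also the valuation ring $\{x/y : x,y\in T,\ y\ne 0,\ \operatorname{ord}_T(x)\ge\operatorname{ord}_T(y)\}$ of $K$. Let $I$ be a finitely supported $\mathfrak m$-primary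 ideal of $R$, let $\overline{R[It]}$ be the integral closure of the Rees algebra $R[It]$ in its field of fractions, graded by the degree in $t$, and let $S$ be a local ring on $\operatorname{Proj}\overline{R[It]}$ that dominates $R$. If $S$ is a unique factorization domain, then $S$ is a regular local ring. Moreover, either $S=\operatorname{ord}_T$ for some base point $T$ of $I$, or $S$ is an infinitely near point to $R$. -/

import Mathlib

open Polynomial IsLocalRing

noncomputable section

namespace FinSupp

section NormalizedRees

variable {R : Type*} [CommRing R] (K : Type*) [Field K] [Algebra R K]

/-- The Rees algebra `R[It] = ⨁ Iⁿ tⁿ`, viewed inside `K[t]`. -/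
def reesIn (I : Ideal R) : Subalgebra R K[X] :=
  (reesAlgebra I).map (Polynomial.mapAlgHom (Algebra.ofId R K))

/-- The integral closure of the Rees algebra `R[It]`. It is taken in `K[t]`; when `K` is the field
of fractions of `R` and `I ≠ 0`, the field of fractions of `R[It]` is `K(t)`, and as `K[t]` is
integrally closed in `K(t)` this is the integral closure of `R[It]` in its field of fractions. -/
def normRees (I : Ideal R) : Subalgebra R K[X] :=
  (integralClosure (reesIn K I) K[X]).restrictScalars R

/-- The elements of degree `n`, that is, of the form `c tⁿ`, of the integral closure of `R[It]`. -/
def normReesPiece (I : Ideal R) (n : ℕ) : Submodule R (normRees K I) :=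
  (LinearMap.range ((Polynomial.monomial n : K →ₗ[K] K[X]).restrictScalars R)).comap
    (normRees K I).val.toLinearMap

variable {K}

theorem mem_normRees {I : Ideal R} {f : K[X]} : f ∈ normRees K I ↔ IsIntegral (reesIn K I) f :=
  Iff.rfl

theorem mem_normReesPiece {I : Ideal R} {n : ℕ} {f : normRees K I} :
    f ∈ normReesPiece K I n ↔ ∃ c : K, monomial n c = (f : K[X]) :=
  Iff.rfl

theorem monomial_coeff_mem_reesIn {I : Ideal R} {f : K[X]} (hf : f ∈ reesIn K I) (n : ℕ) :
    monomial n (f.coeff n) ∈ reesIn K I := by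
  obtain ⟨g, hg, rfl⟩ := hf
  refine ⟨monomial n (g.coeff n), ?_, by simp⟩
  exact reesAlgebra.monomial_mem.2 (hg n)

/-- The ring homomorphism `K[t] → K[t][u]`, `t ↦ t u`. -/
def twist : K[X] →+* K[X][X] := eval₂RingHom (C.comp C) (C X * X)

theorem coeff_twist (f : K[X]) (n : ℕ) : (twist f).coeff n = monomial n (f.coeff n) := by
  have : twist f = f.sum fun i a => monomial i (monomial i a) := by
    simp only [twist, coe_eval₂RingHom, eval₂_eq_sum]
    refine Finset.sum_congr rfl fun i _ => ?_
    simp [mul_pow, ← mul_assoc, ← C_mul_X_pow_eq_monomial]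
  rw [this, Polynomial.sum, finsetSum_coeff]
  simp only [coeff_monomial]
  rw [Finset.sum_ite_eq']
  split_ifs with h
  · rfl
  · simp [notMem_support_iff.1 h]

theorem monomial_coeff_mem_normRees {I : Ideal R} {f : K[X]} (hf : f ∈ normRees K I) (n : ℕ) :
    monomial n (f.coeff n) ∈ normRees K I := by
  rw [mem_normRees] at hf ⊢
  let ψ : (reesIn K I)[X] →+* K[X][X] := mapRingHom (algebraMap (reesIn K I) K[X])
  have hψ : Function.Injective ψ := map_injective _ Subtype.val_injective
  have hmem : ∀ a : reesIn K I, (twist.comp (algebraMap (reesIn K I) K[X])) a ∈ ψ.rangeS := by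
    intro a
    have h : twist (a : K[X]) ∈ lifts (algebraMap (reesIn K I) K[X]) := by
      rw [lifts_iff_coeff_lifts]
      intro k
      rw [coeff_twist]
      exact ⟨⟨_, monomial_coeff_mem_reesIn a.2 k⟩, rfl⟩
    obtain ⟨q, hq⟩ := (mem_lifts _).1 h
    exact ⟨q, hq⟩
  let e : (reesIn K I)[X] ≃+* ψ.rangeS := RingEquiv.ofBijective ψ.rangeSRestrict
    ⟨fun x y hxy => hψ congr(($hxy : K[X][X])), ψ.rangeSRestrict_surjective⟩
  let φ : reesIn K I →+* (reesIn K I)[X] :=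
    e.symm.toRingHom.comp ((twist.comp (algebraMap (reesIn K I) K[X])).codRestrict ψ.rangeS hmem)
  let := Polynomial.algebra (reesIn K I) K[X]
  have hcomp : (algebraMap (reesIn K I)[X] K[X][X]).comp φ = twist.comp (algebraMap (reesIn K I) K[X]) := by
    ext1 a
    have : (e (φ a) : K[X][X]) = twist (algebraMap (reesIn K I) K[X] a) := by simp [φ]
    exact this
  have hint : IsIntegral (reesIn K I)[X] (twist f) := hf.map_of_comp_eq φ twist hcomp
  have := Polynomial.isIntegral_iff_isIntegral_coeff.1 hint n
  rwa [coeff_twist] at this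

/-- The homogeneous component of degree `n`. -/
def component (I : Ideal R) (n : ℕ) (f : normRees K I) : normReesPiece K I n :=
  ⟨⟨monomial n ((f : K[X]).coeff n), monomial_coeff_mem_normRees f.2 n⟩, ⟨_, rfl⟩⟩

instance (I : Ideal R) : SetLike.GradedMonoid (normReesPiece K I) where
  one_mem := ⟨1, rfl⟩
  mul_mem := by
    rintro i j f g ⟨a, ha⟩ ⟨b, hb⟩
    refine ⟨a * b, ?_⟩
    have ha' : monomial i a = (f : K[X]) := ha
    have hb' : monomial j b = (g : K[X]) := hb
    change monomial (i + j) (a * b) = (f : K[X]) * (g : K[X])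
    rw [← ha', ← hb', monomial_mul_monomial]

theorem component_coe (I : Ideal R) (x : DirectSum ℕ fun n => normReesPiece K I n) (n : ℕ) :
    component I n (DirectSum.coeAddMonoidHom (normReesPiece K I) x) = x n := by
  classical
  have hadd : ∀ f g : normRees K I, component I n (f + g) = component I n f + component I n g := by
    intro f g
    apply Subtype.ext
    apply Subtype.ext
    simp [component]
  have hzero : component I n (0 : normRees K I) = 0 := by
    apply Subtype.ext
    apply Subtype.ext
    simp [component]
  induction x using DirectSum.induction_on with
  | zero => simpa using hzero
  | add x y hx hy => rw [map_add, hadd, hx, hy, DirectSum.add_apply]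
  | of i f =>
    rw [DirectSum.coeAddMonoidHom_of]
    obtain ⟨f, c, hc⟩ := f
    have hc' : monomial i c = (f : K[X]) := hc
    rcases eq_or_ne i n with rfl | h
    · rw [DirectSum.of_eq_same]
      apply Subtype.ext
      apply Subtype.ext
      simp [component, ← hc']
    · rw [DirectSum.of_eq_of_ne _ _ _ h.symm]
      apply Subtype.ext
      apply Subtype.ext
      simp [component, ← hc', coeff_monomial, h]

/-- The integral closure of `R[It]` is graded by the degree in `t`. -/
instance (I : Ideal R) : GradedAlgebra (normReesPiece K I) where
  decompose' f := DFinsupp.mk (f : K[X]).support fun n => component I n f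
  left_inv f := by
    classical
    apply Subtype.ext
    ext n
    have h := component_coe I (DFinsupp.mk (f : K[X]).support fun n => component I n f) n
    have h' := congrArg (fun z : normReesPiece K I n => ((z : normRees K I) : K[X]).coeff n) h
    rw [DFinsupp.mk_apply] at h'
    split_ifs at h' with hn
    · simpa [component] using h'
    · simpa [component, notMem_support_iff.1 hn] using h'
  right_inv x := by
    classical
    refine DFinsupp.ext fun n => ?_
    rw [DFinsupp.mk_apply]
    split_ifs with h
    · exact component_coe I x n
    · rw [← component_coe I x n]
      apply Subtype.ext
      apply Subtype.ext
      simp [component, notMem_support_iff.1 h]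

end NormalizedRees
section Points

variable {K : Type*} [Field K]

/-- The affine chart `A[𝔪/x]` of the blowup of the maximal ideal `𝔪` of a local subring `A`. -/
def quadraticChart (A : LocalSubring K) (x : A.toSubring) : Subring K :=
  Subring.closure ((A.toSubring : Set K) ∪
    {k | ∃ y ∈ maximalIdeal A.toSubring, k = (y : K) / (x : K)})

/-- `B` is a local quadratic transform of `A`: a local ring on `Proj A[𝔪 t]`, that is,
`B = A[𝔪/x]_P` for some nonzero `x ∈ 𝔪` and some prime `P`, that dominates `A`. -/
def IsLocalQuadraticTransform (A B : LocalSubring K) : Prop :=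
  (∃ x ∈ maximalIdeal A.toSubring, x ≠ 0 ∧
    ∃ (P : Ideal (quadraticChart A x)) (_ : P.IsPrime),
      B = LocalSubring.ofPrime (quadraticChart A x) P) ∧
  A ≤ B

/-- `S` is an infinitely near point to `A`: a regular local ring of dimension at least two that
dominates `A` and is obtained from `A` by a finite, possibly empty, sequence of local quadratic
transforms. The order on `LocalSubring K` is domination. -/
def IsInfinitelyNear (A S : LocalSubring K) : Prop :=
  IsRegularLocalRing S.toSubring ∧ 2 ≤ ringKrullDim S.toSubring ∧ A ≤ S ∧
    Relation.ReflTransGen IsLocalQuadraticTransform A S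

/-- The order of an element of a local ring: the supremum of the `n` with `x ∈ 𝔪ⁿ`. -/
def ord (A : Type*) [CommRing A] [IsLocalRing A] (x : A) : ℕ∞ :=
  ⨆ (n : ℕ) (_ : x ∈ maximalIdeal A ^ n), (n : ℕ∞)

/-- The order valuation ring of a (regular) local subring `T` with field of fractions `K`: the
fractions `x / y` of elements of `T` with `ord x ≥ ord y`. -/
def ordValuationRing (T : LocalSubring K) : Set K :=
  {k | ∃ x y : T.toSubring, y ≠ 0 ∧ ord T.toSubring y ≤ ord T.toSubring x ∧ k = (x : K) / (y : K)}

variable {R : Type*} [CommRing R] [Algebra R K]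

/-- The extension `IS` of the ideal `I` of `R` to a subring `S` of `K` containing `R`. -/
def extension (I : Ideal R) (S : Subring K) : Ideal S :=
  Ideal.span {s | ∃ r ∈ I, (s : K) = algebraMap R K r}

/-- `J` is the transform of `I` in `S`: `J = a⁻¹ IS`, where `aS` is the smallest principal ideal of
`S` containing `IS`. -/
def IsTransform (I : Ideal R) (S : Subring K) (J : Ideal S) : Prop :=
  ∃ a : S, a ≠ 0 ∧
    IsLeast {P : Ideal S | P.IsPrincipal ∧ extension I S ≤ P} (Ideal.span {a}) ∧
    Ideal.span {a} * J = extension I S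

/-- `S` is a local ring on `Proj` of the integral closure of `R[It]`: the ring of all fractions
`a tⁿ / b tⁿ` of homogeneous elements of equal degree with denominator outside a point of `Proj`. -/
def IsOnNormalizedBlowup (I : Ideal R) (S : LocalSubring K) : Prop :=
  ∃ p : ProjectiveSpectrum (normReesPiece K I),
    (S.toSubring : Set K) = {k | ∃ n : ℕ, ∃ a ∈ normReesPiece K I n, ∃ b ∈ normReesPiece K I n,
      b ∉ p.asHomogeneousIdeal ∧ k = (a : K[X]).coeff n / (b : K[X]).coeff n}

variable [IsLocalRing R]

/-- `S` is a base point of `I`: an infinitely near point to `R` in which the transform of `I` is a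
proper ideal. -/
def IsBasePoint (I : Ideal R) (S : LocalSubring K) : Prop :=
  IsInfinitelyNear (LocalSubring.range (algebraMap R K)) S ∧
    ∃ J : Ideal S.toSubring, IsTransform I S.toSubring J ∧ J ≠ ⊤

variable (K) in
/-- `I` is finitely supported: it has only finitely many base points. -/
def IsFinitelySupported (I : Ideal R) : Prop :=
  {S : LocalSubring K | IsBasePoint I S}.Finite

end Points

end FinSupp

end

/-
The ring `S` dominates `R` and `I` has finitely many base points, so there is a maximal base point
`T` dominated by `S`. The point is that the maximal ideal `𝔪` of `T` becomes principal in `S`. Let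
`b ∈ S` be the greatest common divisor of `𝔪`; it is a nonunit, because `𝔪` is the only nonzero
prime of `T` containing the transform of `I`, and this transform becomes principal in `S`. If `b`
does not generate `𝔪S`, then prime avoidance gives a valuation ring that dominates `S` and whose
center `T'` on the blowup of `𝔪` is not a base point. Then `I` becomes principal in `T'`, so `T'`
dominates `S`, and the generator of `𝔪T'` is a prime element that is a product of two nonunits.

Now let `T'` be the center of `S` on the blowup of `𝔪`. By maximality of `T`, it is not a base
point, so `I` becomes principal in it. Hence `S ≤ T' ≤ S`, and `T'` is an infinitely near point to
`R` or, in dimension one, the order valuation ring of `T`.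
-/

noncomputable section

namespace FinSupp

section RegularParameters

theorem eval₂_mul_of_isHomogeneous {ι R A : Type*} [CommSemiring R] [CommSemiring A]
    {F : MvPolynomial ι R} {n : ℕ} (hF : F.IsHomogeneous n) (φ : R →+* A) (t : A) (x : ι → A) :
    F.eval₂ φ (fun i => t * x i) = t ^ n * F.eval₂ φ x := by
  simp only [MvPolynomial.eval₂_eq, Finset.mul_sum]
  refine Finset.sum_congr rfl fun d hd => ?_
  simp only [mul_pow, Finset.prod_mul_distrib, Finset.prod_pow_eq_pow_sum,
    ← hF.degree_eq_sum_deg_support hd]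
  ring

theorem isPrime_map_C {ι R : Type*} [CommRing R] (p : Ideal R) [p.IsPrime] :
    (p.map (MvPolynomial.C : R →+* MvPolynomial ι R)).IsPrime := by
  have hp : p = RingHom.ker (Ideal.Quotient.mk p) := Ideal.mk_ker.symm
  rw [hp, ← MvPolynomial.ker_map]
  exact RingHom.ker_isPrime _

theorem height_le_height_map_C {ι R : Type*} [CommRing R] [IsNoetherianRing R] [Finite ι]
    (p : Ideal R) [p.IsPrime] :
    p.height ≤ (p.map (MvPolynomial.C : R →+* MvPolynomial ι R)).height := by
  have : Nontrivial R := nontrivial_of_ne 1 0 fun h => p.one_notMem (h ▸ p.zero_mem)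
  have : (p.map (algebraMap R (MvPolynomial ι R))).IsPrime := isPrime_map_C p
  have : (p.map (algebraMap R (MvPolynomial ι R))).LiesOver p :=
    ⟨(Ideal.comap_map_eq_self_of_faithfullyFlat p).symm⟩
  exact (Ideal.height_eq_height_add_of_liesOver_of_hasGoingDown p
    (p.map (algebraMap R (MvPolynomial ι R)))).ge.trans' le_self_add

section AnalyticIndependence

variable {ι R : Type*} [CommRing R] {x : ι → R} {F : MvPolynomial ι R} {n : ℕ} {i₀ : ι}

/-- The relations `Xᵢ₀ xᵢ - Xᵢ xᵢ₀` satisfied by `Xᵢ ↦ xᵢ t` in the Rees algebra of the ideal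
generated by the `xᵢ`. -/
def crossRelations (x : ι → R) (i₀ : ι) : Set (MvPolynomial ι R) :=
  (fun i => MvPolynomial.X i₀ * MvPolynomial.C (x i) - MvPolynomial.X i * MvPolynomial.C (x i₀)) ''
    {i₀}ᶜ

theorem mk_X_mul_C_eq_of_crossRelations_subset {q : Ideal (MvPolynomial ι R)}
    (hq : crossRelations x i₀ ⊆ q) (i : ι) :
    Ideal.Quotient.mk q (MvPolynomial.X i₀) * Ideal.Quotient.mk q (MvPolynomial.C (x i)) =
      Ideal.Quotient.mk q (MvPolynomial.C (x i₀)) * Ideal.Quotient.mk q (MvPolynomial.X i) := by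
  rcases eq_or_ne i i₀ with rfl | hi
  · rw [mul_comm]
  · rw [← map_mul, ← map_mul, Ideal.Quotient.eq, mul_comm (MvPolynomial.C (x i₀))]
    exact hq ⟨i, hi, rfl⟩

theorem C_pow_mul_mem_of_eval_eq_zero {q : Ideal (MvPolynomial ι R)}
    (hq : crossRelations x i₀ ⊆ q) (hF : F.IsHomogeneous n) (h0 : MvPolynomial.eval x F = 0) :
    MvPolynomial.C (x i₀) ^ n * F ∈ q := by
  let φ : R →+* MvPolynomial ι R ⧸ q := (Ideal.Quotient.mk q).comp MvPolynomial.C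
  have hvalue : F.eval₂ φ (fun i => φ (x i)) = 0 := by
    have := MvPolynomial.eval₂_comp_left φ (RingHom.id R) x F
    rw [MvPolynomial.eval₂_id, h0, map_zero] at this
    exact this.symm
  have hmk : F.eval₂ φ (fun i => Ideal.Quotient.mk q (MvPolynomial.X i)) =
      Ideal.Quotient.mk q F := by
    have := MvPolynomial.eval₂_comp_left (Ideal.Quotient.mk q) MvPolynomial.C MvPolynomial.X F
    rw [MvPolynomial.eval₂_eta] at this
    exact this.symm
  rw [← Ideal.Quotient.eq_zero_iff_mem, map_mul, map_pow]
  calc φ (x i₀) ^ n * Ideal.Quotient.mk q F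
      = F.eval₂ φ (fun i => φ (x i₀) * Ideal.Quotient.mk q (MvPolynomial.X i)) := by
        rw [eval₂_mul_of_isHomogeneous hF, hmk]
    _ = F.eval₂ φ (fun i => Ideal.Quotient.mk q (MvPolynomial.X i₀) * φ (x i)) := by
        congr 1
        funext i
        exact (mk_X_mul_C_eq_of_crossRelations_subset hq i).symm
    _ = 0 := by rw [eval₂_mul_of_isHomogeneous hF, hvalue, mul_zero]

theorem X_notMem_map_C {p : Ideal R} (hp : p ≠ ⊤) (i : ι) :
    MvPolynomial.X i ∉ p.map (MvPolynomial.C : R →+* MvPolynomial ι R) := by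
  classical
  intro h
  have hcoeff := MvPolynomial.mem_map_C_iff.1 h (Finsupp.single i 1)
  rw [MvPolynomial.coeff_X, if_pos rfl] at hcoeff
  exact hp ((Ideal.eq_top_iff_one _).2 hcoeff)

theorem map_C_mem_minimalPrimes_crossRelations {p : Ideal R} [p.IsPrime]
    (hx : Ideal.span (Set.range x) = p) (hF : F.IsHomogeneous n)
    (h0 : MvPolynomial.eval x F = 0) (hFp : F ∉ p.map MvPolynomial.C) (i₀ : ι) :
    p.map MvPolynomial.C ∈ (Ideal.span (crossRelations x i₀)).minimalPrimes := by
  have hmem (i) : MvPolynomial.C (x i) ∈ p.map (MvPolynomial.C : R →+* MvPolynomial ι R) :=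
    Ideal.mem_map_of_mem _ (hx ▸ Ideal.subset_span ⟨i, rfl⟩)
  refine ⟨⟨isPrime_map_C p, Ideal.span_le.2 ?_⟩, ?_⟩
  · rintro _ ⟨i, -, rfl⟩
    exact sub_mem (Ideal.mul_mem_left _ _ (hmem i)) (Ideal.mul_mem_left _ _ (hmem i₀))
  rintro q ⟨hq, hrel⟩ hqp
  have hrel' : crossRelations x i₀ ⊆ q := Ideal.span_le.1 hrel
  have hx₀ : MvPolynomial.C (x i₀) ∈ q := hq.mem_of_pow_mem _
    ((hq.mem_or_mem (C_pow_mul_mem_of_eval_eq_zero hrel' hF h0)).resolve_right fun h => hFp (hqp h))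
  rw [Ideal.map_le_iff_le_comap, ← hx, Ideal.span_le]
  rintro _ ⟨i, rfl⟩
  refine (hq.mem_or_mem (x := MvPolynomial.X i₀) ?_).resolve_left fun h =>
    X_notMem_map_C (Ideal.IsPrime.ne_top ‹_›) i₀ (hqp h)
  rw [← Ideal.Quotient.eq_zero_iff_mem, map_mul,
    mk_X_mul_C_eq_of_crossRelations_subset hrel' i, Ideal.Quotient.eq_zero_iff_mem.2 hx₀, zero_mul]

theorem mem_map_C_of_isHomogeneous_of_eval_eq_zero [Finite ι] [IsNoetherianRing R] {p : Ideal R}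
    [p.IsPrime] (hx : Ideal.span (Set.range x) = p) (hcard : (Nat.card ι : ℕ∞) ≤ p.height)
    (hF : F.IsHomogeneous n) (h0 : MvPolynomial.eval x F = 0) : F ∈ p.map MvPolynomial.C := by
  by_contra hFp
  rcases isEmpty_or_nonempty ι with hι | ⟨⟨i₀⟩⟩
  · refine hFp ?_
    rw [MvPolynomial.eq_C_of_isEmpty F, MvPolynomial.eval_C] at h0
    rw [MvPolynomial.eq_C_of_isEmpty F, h0, map_zero]
    exact zero_mem _
  have hlt : (crossRelations x i₀).ncard < Nat.card ι := by
    refine (Set.ncard_image_le (Set.toFinite _)).trans_lt ?_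
    rw [← Set.ncard_univ]
    exact Set.ncard_lt_ncard ⟨Set.subset_univ _, fun h => h (Set.mem_univ i₀) rfl⟩ (Set.toFinite _)
  have hle := Ideal.height_le_card_of_mem_minimalPrimes_span (Set.Finite.image _ (Set.toFinite _))
    (map_C_mem_minimalPrimes_crossRelations hx hF h0 hFp i₀)
  exact hlt.not_ge (by exact_mod_cast (hcard.trans (height_le_height_map_C p)).trans hle)

end AnalyticIndependence

/-- A regular system of parameters of a local ring: a family generating the maximal ideal with no
more members than the height of that ideal. The index type is meant to be finite, since `Nat.card`
of an infinite type is `0`. -/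
structure IsRegularParameters {ι R : Type*} [CommRing R] [IsLocalRing R] (x : ι → R) : Prop where
  span_range : Ideal.span (Set.range x) = maximalIdeal R
  card_le_height : (Nat.card ι : ℕ∞) ≤ (maximalIdeal R).height

theorem height_maximalIdeal_eq_spanFinrank (R : Type*) [CommRing R] [IsRegularLocalRing R] :
    (maximalIdeal R).height = ((maximalIdeal R).spanFinrank : ℕ∞) := by
  have h := IsRegularLocalRing.spanFinrank_maximalIdeal (R := R)
  rw [← maximalIdeal_height_eq_ringKrullDim] at h
  exact_mod_cast h.symm

theorem isRegularParameters_generators (R : Type*) [CommRing R] [IsRegularLocalRing R] :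
    IsRegularParameters (Subtype.val : (maximalIdeal R).generators → R) where
  span_range := by
    rw [Subtype.range_coe]
    exact Submodule.span_generators _
  card_le_height := by
    rw [height_maximalIdeal_eq_spanFinrank,
      ← Submodule.FG.generators_ncard (maximalIdeal R).fg_of_isNoetherianRing]
    rfl

theorem exists_isRegularParameters_none_eq {R : Type*} [CommRing R] [IsRegularLocalRing R] {x₀ : R}
    (hx₀ : x₀ ∈ maximalIdeal R) (hx₀' : x₀ ∉ maximalIdeal R ^ 2) :
    ∃ (n : ℕ) (x : Option (Fin n) → R), IsRegularParameters x ∧ x none = x₀ := by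
  classical
  let v₀ : CotangentSpace R := (maximalIdeal R).toCotangent ⟨x₀, hx₀⟩
  have hv₀ : v₀ ≠ 0 := fun h => hx₀' ((Ideal.toCotangent_eq_zero _ _).1 h)
  obtain ⟨n, b, hb⟩ : ∃ (n : ℕ) (b : Module.Basis (Option (Fin n)) (ResidueField R)
      (CotangentSpace R)), b none = v₀ := by
    have hli : LinearIndepOn (ResidueField R) id ({v₀} : Set (CotangentSpace R)) := .singleton hv₀
    let B := Module.Basis.extend hli
    let j₀ : hli.extend (Set.subset_univ _) := ⟨v₀, hli.subset_extend _ rfl⟩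
    have := Module.Finite.finite_basis B
    let e := Finite.equivFin {j // j ≠ j₀}
    exact ⟨_, B.reindex ((Equiv.optionSubtypeNe j₀).symm.trans (Equiv.optionCongr e)),
      by rw [Module.Basis.reindex_apply, Module.Basis.extend_apply_self]; rfl⟩
  choose lift hlift using (maximalIdeal R).toCotangent_surjective
  let y : Option (Fin n) → maximalIdeal R := fun o => o.elim ⟨x₀, hx₀⟩ fun i => lift (b (some i))
  have hy : (maximalIdeal R).toCotangent ∘ y = b := by
    funext o
    cases o with
    | none => exact hb.symm
    | some i => exact hlift _
  have hspan : Submodule.span R (Set.range y) = ⊤ := by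
    rw [← CotangentSpace.span_image_eq_top_iff, ← Set.range_comp, hy]
    exact b.span_eq
  refine ⟨n, fun o => y o, ⟨?_, ?_⟩, rfl⟩
  · have := congrArg (Submodule.map (maximalIdeal R).subtype) hspan
    rwa [Submodule.map_span, Submodule.map_subtype_top, ← Set.range_comp] at this
  · rw [height_maximalIdeal_eq_spanFinrank, spanFinrank_maximalIdeal_eq_finrank_cotangentSpace,
      Module.finrank_eq_nat_card_basis b]

theorem exists_mem_pow_notMem_pow_succ {R : Type*} [CommRing R] [IsLocalRing R]
    [IsNoetherianRing R] {f : R} (hf : f ≠ 0) :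
    ∃ n : ℕ, f ∈ maximalIdeal R ^ n ∧ f ∉ maximalIdeal R ^ (n + 1) := by
  by_contra! h
  have hpow (n : ℕ) : f ∈ maximalIdeal R ^ n := by
    induction n with
    | zero => simp
    | succ n ih => exact h n ih
  refine hf ?_
  rw [← Ideal.mem_bot, ← Ideal.iInf_pow_eq_bot_of_isLocalRing _ (maximalIdeal.isMaximal R).ne_top]
  exact Ideal.mem_iInf.2 hpow

namespace IsRegularParameters

variable {ι R : Type*} [CommRing R] [IsLocalRing R] {x : ι → R} {F G : MvPolynomial ι R} {n m : ℕ}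

theorem mem_maximalIdeal (hx : IsRegularParameters x) (i : ι) : x i ∈ maximalIdeal R :=
  hx.span_range ▸ Ideal.subset_span ⟨i, rfl⟩

theorem mem_pow_iff (hx : IsRegularParameters x) {f : R} :
    f ∈ maximalIdeal R ^ n ↔ ∃ F : MvPolynomial ι R, F.IsHomogeneous n ∧ F.eval x = f := by
  rw [← hx.span_range]
  exact Ideal.mem_span_pow_iff_exists_isHomogeneous x f

variable [Finite ι] [IsNoetherianRing R]

theorem map_residue_eq_zero_of_eval_eq_zero (hx : IsRegularParameters x) (hF : F.IsHomogeneous n)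
    (h0 : F.eval x = 0) : F.map (residue R) = 0 := by
  rw [← RingHom.mem_ker, MvPolynomial.ker_map, ker_residue]
  exact mem_map_C_of_isHomogeneous_of_eval_eq_zero hx.span_range hx.card_le_height hF h0

theorem ne_zero (hx : IsRegularParameters x) (i : ι) : x i ≠ 0 := by
  intro h
  have := hx.map_residue_eq_zero_of_eval_eq_zero (MvPolynomial.isHomogeneous_X R i)
    (by rwa [MvPolynomial.eval_X])
  rw [MvPolynomial.map_X] at this
  exact MvPolynomial.X_ne_zero i this

-- The associated graded ring of `R` is a polynomial ring over the residue field.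
theorem eval_mem_pow_succ_iff (hx : IsRegularParameters x) (hF : F.IsHomogeneous n) :
    F.eval x ∈ maximalIdeal R ^ (n + 1) ↔ F.map (residue R) = 0 := by
  constructor
  · intro h
    obtain ⟨G, hG, hG0, hFG⟩ : ∃ G : MvPolynomial ι R, G.IsHomogeneous n ∧
        G.map (residue R) = 0 ∧ G.eval x = F.eval x := by
      generalize F.eval x = f at h
      rw [pow_succ] at h
      refine Submodule.mul_induction_on h ?_ ?_
      · intro g hg c hc
        obtain ⟨G, hG, rfl⟩ := hx.mem_pow_iff.1 hg
        exact ⟨MvPolynomial.C c * G, hG.C_mul c, by simp [(residue_eq_zero_iff c).2 hc],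
          by simp [mul_comm]⟩
      · rintro f g ⟨F, hF, hF0, rfl⟩ ⟨G, hG, hG0, rfl⟩
        exact ⟨F + G, hF.add hG, by simp [hF0, hG0], by simp⟩
    have := hx.map_residue_eq_zero_of_eval_eq_zero (hF.sub hG) (by simp [hFG])
    rwa [map_sub, hG0, sub_zero] at this
  · intro h0
    rw [MvPolynomial.eval_eq]
    refine Ideal.sum_mem _ fun d hd => ?_
    have hcoeff : F.coeff d ∈ maximalIdeal R := by
      rw [← residue_eq_zero_iff, ← MvPolynomial.coeff_map, h0, MvPolynomial.coeff_zero]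
    rw [pow_succ', hF.degree_eq_sum_deg_support hd, ← Finset.prod_pow_eq_pow_sum]
    exact Ideal.mul_mem_mul hcoeff
      (Ideal.prod_mem_prod fun i _ => Ideal.pow_mem_pow (hx.mem_maximalIdeal i) _)

theorem mem_pow_succ_of_mul_pow_mem (hx : IsRegularParameters x) {f : R} {j : ι} {m : ℕ}
    (hf : f ∈ maximalIdeal R ^ n) (h : f * x j ^ m ∈ maximalIdeal R ^ (n + m + 1)) :
    f ∈ maximalIdeal R ^ (n + 1) := by
  obtain ⟨F, hF, rfl⟩ := hx.mem_pow_iff.1 hf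
  have hFX := hF.mul ((MvPolynomial.isHomogeneous_X R j).pow m)
  rw [one_mul] at hFX
  have h0 := (hx.eval_mem_pow_succ_iff hFX).1 (by simpa using h)
  rw [map_mul, map_pow, MvPolynomial.map_X] at h0
  exact (hx.eval_mem_pow_succ_iff hF).2
    ((mul_eq_zero.1 h0).resolve_right (pow_ne_zero m (MvPolynomial.X_ne_zero j)))

theorem exists_initialForm (hx : IsRegularParameters x) {f : R} (hf : f ≠ 0) :
    ∃ (n : ℕ) (F : MvPolynomial ι R), F.IsHomogeneous n ∧ F.eval x = f ∧
      F.map (residue R) ≠ 0 := by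
  obtain ⟨n, hn, hn'⟩ := exists_mem_pow_notMem_pow_succ hf
  obtain ⟨F, hF, rfl⟩ := hx.mem_pow_iff.1 hn
  exact ⟨n, F, hF, rfl, mt (hx.eval_mem_pow_succ_iff hF).2 hn'⟩

theorem map_residue_eq_of_eval_eq (hx : IsRegularParameters x) (hF : F.IsHomogeneous n)
    (hG : G.IsHomogeneous m) (hF0 : F.map (residue R) ≠ 0) (hG0 : G.map (residue R) ≠ 0)
    (h : F.eval x = G.eval x) : F.map (residue R) = G.map (residue R) := by
  rcases lt_trichotomy n m with hnm | rfl | hnm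
  · exact absurd ((hx.eval_mem_pow_succ_iff hF).1
      (Ideal.pow_le_pow_right hnm (hx.mem_pow_iff.2 ⟨G, hG, h.symm⟩))) hF0
  · have := hx.map_residue_eq_zero_of_eval_eq_zero (hF.sub hG) (by simp [h])
    rwa [map_sub, sub_eq_zero] at this
  · exact absurd ((hx.eval_mem_pow_succ_iff hG).1
      (Ideal.pow_le_pow_right hnm (hx.mem_pow_iff.2 ⟨F, hF, h⟩))) hG0

end IsRegularParameters

end RegularParameters

section Normality

theorem pow_dvd_mul_sub_mul_pow {R : Type*} [CommRing R] {f g h : R}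
    (H : ∀ k : ℕ, g ^ k ∣ h * f ^ k) (s : R) (k : ℕ) : g ^ k ∣ h * (f - g * s) ^ k := by
  rw [sub_eq_add_neg, add_pow, Finset.mul_sum]
  refine Finset.dvd_sum fun i hi => ?_
  calc g ^ k = g ^ i * g ^ (k - i) := by
        rw [← pow_add, Nat.add_sub_cancel' (Finset.mem_range_succ_iff.1 hi)]
    _ ∣ h * f ^ i * (-(g * s)) ^ (k - i) :=
        mul_dvd_mul (H i) (pow_dvd_pow_of_dvd ((dvd_mul_right g s).neg_right) _)
    _ ∣ h * (f ^ i * (-(g * s)) ^ (k - i) * k.choose i) := by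
        rw [← mul_assoc, ← mul_assoc]
        exact dvd_mul_right _ _

theorem dvd_of_forall_pow_dvd_mul_pow {A : Type*} [CommRing A] [IsDomain A]
    [UniqueFactorizationMonoid A] {a b h : A} (hh : h ≠ 0) (hb : b ≠ 0)
    (H : ∀ k : ℕ, b ^ k ∣ h * a ^ k) : b ∣ a := by
  obtain ⟨a', b', c, hrel, rfl, rfl⟩ := UniqueFactorizationMonoid.exists_reduced_factors' a b hb
  have hc : c ≠ 0 := left_ne_zero_of_mul hb
  have hdvd (k : ℕ) : b' ^ k ∣ h := by
    have hk := H k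
    rw [mul_pow, mul_pow, mul_left_comm] at hk
    exact (IsRelPrime.pow hrel.symm).dvd_of_dvd_mul_right
      ((mul_dvd_mul_iff_left (pow_ne_zero k hc)).1 hk)
  have hu : IsUnit b' := by
    by_contra hu
    obtain ⟨n, hn⟩ := FiniteMultiplicity.of_not_isUnit hu hh
    exact hn (hdvd _)
  exact mul_dvd_mul_left c hu.dvd

theorem exists_isHomogeneous_mul_eq {σ k : Type*} [Field k] {F G : MvPolynomial σ k} {l n : ℕ}
    (hF : F.IsHomogeneous l) (hG : G.IsHomogeneous n) (hF0 : F ≠ 0) (h : G ∣ F) :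
    n ≤ l ∧ ∃ N : MvPolynomial σ k, N.IsHomogeneous (l - n) ∧ F = G * N := by
  let := MvPolynomial.gradedAlgebra (σ := σ) (R := k)
  obtain ⟨N, rfl⟩ := h
  have hcomponent := DirectSum.coe_decompose_mul_of_left_mem
    (MvPolynomial.homogeneousSubmodule σ k) (b := N) l hG
  rw [DirectSum.decompose_of_mem_same _ hF] at hcomponent
  split_ifs at hcomponent with hnl
  · exact ⟨hnl, _, (DirectSum.decompose (MvPolynomial.homogeneousSubmodule σ k) N (l - n)).2,
      hcomponent⟩
  · exact absurd hcomponent hF0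

theorem exists_lift_isHomogeneous {σ R k : Type*} [CommSemiring R] [CommSemiring k] {φ : R →+* k}
    (hφ : Function.Surjective φ) {N : MvPolynomial σ k} {n : ℕ} (hN : N.IsHomogeneous n) :
    ∃ M : MvPolynomial σ R, M.IsHomogeneous n ∧ M.map φ = N := by
  obtain ⟨M, rfl⟩ := MvPolynomial.map_surjective φ hφ N
  refine ⟨M.homogeneousComponent n, M.homogeneousComponent_isHomogeneous n, ?_⟩
  have hself := MvPolynomial.homogeneousComponent_of_mem (m := n) hN
  rw [if_pos rfl] at hself
  ext d
  rw [← hself]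
  simp only [MvPolynomial.coeff_map, MvPolynomial.coeff_homogeneousComponent]
  split_ifs <;> simp

-- Krull's intersection theorem in the quotient by `J`.
theorem mem_of_forall_mem_sup_pow {R : Type*} [CommRing R] [IsLocalRing R] [IsNoetherianRing R]
    {J : Ideal R} {f : R} (h : ∀ n : ℕ, f ∈ J ⊔ maximalIdeal R ^ n) : f ∈ J := by
  have hbot : (⨅ n : ℕ, maximalIdeal R ^ n • (⊤ : Submodule R (R ⧸ J))) = ⊥ :=
    Ideal.iInf_pow_smul_eq_bot_of_isLocalRing _ (maximalIdeal.isMaximal R).ne_top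
  rw [← Ideal.Quotient.eq_zero_iff_mem, ← Submodule.mem_bot R, ← hbot, Submodule.mem_iInf]
  intro n
  obtain ⟨a, ha, b, hb, rfl⟩ := Submodule.mem_sup.1 (h n)
  rw [map_add, Ideal.Quotient.eq_zero_iff_mem.2 ha, zero_add]
  have := Submodule.smul_mem_smul hb (Submodule.mem_top (x := (1 : R ⧸ J)))
  rwa [Algebra.smul_def, mul_one] at this

namespace IsRegularParameters

variable {ι R : Type*} [Finite ι] [CommRing R] [IsDomain R] [IsLocalRing R] [IsNoetherianRing R]
  {x : ι → R}

theorem map_residue_dvd_of_forall_pow_dvd (hx : IsRegularParameters x) {F G : MvPolynomial ι R}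
    {l n : ℕ} (hF : F.IsHomogeneous l) (hF0 : F.map (residue R) ≠ 0) (hG : G.IsHomogeneous n)
    (hG0 : G.map (residue R) ≠ 0) {h : R} (hh : h ≠ 0)
    (H : ∀ k : ℕ, G.eval x ^ k ∣ h * F.eval x ^ k) : G.map (residue R) ∣ F.map (residue R) := by
  have hf0 : F.eval x ≠ 0 := fun h0 => hF0 (hx.map_residue_eq_zero_of_eval_eq_zero hF h0)
  obtain ⟨p, P, hP, rfl, hP0⟩ := hx.exists_initialForm hh
  refine dvd_of_forall_pow_dvd_mul_pow hP0 hG0 fun k => ?_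
  obtain ⟨r, hr⟩ := H k
  have hr0 : r ≠ 0 := by
    rintro rfl
    rw [mul_zero] at hr
    exact mul_ne_zero hh (pow_ne_zero k hf0) hr
  obtain ⟨q, M, hM, rfl, hM0⟩ := hx.exists_initialForm hr0
  refine ⟨M.map (residue R), ?_⟩
  simpa only [map_mul, map_pow] using hx.map_residue_eq_of_eval_eq (hP.mul (hF.pow k))
    ((hG.pow k).mul hM) (by simp [hP0, hF0]) (by simp [hG0, hM0]) (by simpa using hr)

theorem exists_sub_mul_mem_pow_succ (hx : IsRegularParameters x) {f g h : R} {l : ℕ} (hg : g ≠ 0)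
    (hh : h ≠ 0) (H : ∀ k : ℕ, g ^ k ∣ h * f ^ k) (hf : f ∈ maximalIdeal R ^ l) :
    ∃ s, f - g * s ∈ maximalIdeal R ^ (l + 1) := by
  obtain ⟨F, hF, rfl⟩ := hx.mem_pow_iff.1 hf
  by_cases hF0 : F.map (residue R) = 0
  · exact ⟨0, by simpa using (hx.eval_mem_pow_succ_iff hF).2 hF0⟩
  obtain ⟨n, G, hG, rfl, hG0⟩ := hx.exists_initialForm hg
  obtain ⟨hnl, N, hN, hFN⟩ := exists_isHomogeneous_mul_eq (hF.map _) (hG.map _) hF0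
    (hx.map_residue_dvd_of_forall_pow_dvd hF hF0 hG hG0 hh H)
  obtain ⟨M, hM, rfl⟩ := exists_lift_isHomogeneous residue_surjective hN
  have hGM : (G * M).IsHomogeneous l := Nat.add_sub_cancel' hnl ▸ hG.mul hM
  refine ⟨M.eval x, ?_⟩
  rw [← map_mul, ← map_sub, hx.eval_mem_pow_succ_iff (hF.sub hGM), map_sub, map_mul, hFN, sub_self]

theorem dvd_of_forall_pow_dvd_mul_pow (hx : IsRegularParameters x) {f g h : R} (hg : g ≠ 0)
    (hh : h ≠ 0) (H : ∀ k : ℕ, g ^ k ∣ h * f ^ k) : g ∣ f := by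
  rw [← Ideal.mem_span_singleton]
  refine mem_of_forall_mem_sup_pow fun l => ?_
  obtain ⟨s, hs⟩ : ∃ s, f - g * s ∈ maximalIdeal R ^ l := by
    induction l with
    | zero => exact ⟨0, by simp⟩
    | succ l ih =>
      obtain ⟨s, hs⟩ := ih
      obtain ⟨t, ht⟩ := hx.exists_sub_mul_mem_pow_succ hg hh (pow_dvd_mul_sub_mul_pow H s) hs
      exact ⟨s + t, by rwa [mul_add, ← sub_sub]⟩
  exact Submodule.mem_sup.2
    ⟨g * s, Ideal.mem_span_singleton.2 (dvd_mul_right g s), _, hs, by ring⟩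

end IsRegularParameters

instance isIntegrallyClosed_of_isRegularLocalRing {R : Type*} [CommRing R] [IsDomain R]
    [IsRegularLocalRing R] : IsIntegrallyClosed R := by
  refine (isIntegrallyClosed_iff (FractionRing R)).2 fun {z} hz => ?_
  have : Finite (maximalIdeal R).generators :=
    Submodule.FG.finite_generators (maximalIdeal R).fg_of_isNoetherianRing
  obtain ⟨h, hh, hpow⟩ := hz.isAlmostIntegral
  obtain ⟨f, g, hg, rfl⟩ := IsFractionRing.div_surjective (A := R) z
  have hg0 : g ≠ 0 := nonZeroDivisors.ne_zero hg
  have hgK : algebraMap R (FractionRing R) g ≠ 0 := by simpa using hg0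
  have hdvd (k : ℕ) : g ^ k ∣ h * f ^ k := by
    obtain ⟨r, hr⟩ := hpow k
    refine ⟨r, IsFractionRing.injective R (FractionRing R) ?_⟩
    rw [Algebra.smul_def, div_pow] at hr
    rw [map_mul, map_mul, map_pow, map_pow, hr]
    field_simp
  obtain ⟨s, rfl⟩ := (isRegularParameters_generators R).dvd_of_forall_pow_dvd_mul_pow hg0
    (nonZeroDivisors.ne_zero hh) hdvd
  exact ⟨s, by rw [map_mul, mul_div_cancel_left₀ _ hgK]⟩

end Normality

section RegularQuotient

theorem spanFinrank_le_spanFinrank_map_mk_add_one {B : Type*} [CommRing B] {x : B} {I : Ideal B}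
    (hx : x ∈ I) (hfg : (I.map (Ideal.Quotient.mk (Ideal.span {x}))).FG) :
    I.spanFinrank ≤ (I.map (Ideal.Quotient.mk (Ideal.span {x}))).spanFinrank + 1 := by
  let π := Ideal.Quotient.mk (Ideal.span {x})
  have hπ : Function.Surjective π := Ideal.Quotient.mk_surjective
  obtain ⟨s, hcard, hspan⟩ := Submodule.FG.exists_span_finset_card_eq_spanFinrank hfg
  let t : Set B := Function.surjInv hπ '' s
  have hmap : (Ideal.span t).map π = I.map π := by
    rw [Ideal.map_span, ← Set.image_comp, (Function.rightInverse_surjInv hπ).comp_eq_id,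
      Set.image_id]
    exact hspan
  have hker (J : Ideal B) : (J.map π).comap π = J ⊔ Ideal.span {x} := by
    rw [Ideal.comap_map_of_surjective' π hπ, Ideal.mk_ker]
  have hI : Ideal.span (insert x t) = I := by
    rw [Ideal.span_insert, sup_comm, ← hker, hmap, hker,
      sup_eq_left.2 ((Ideal.span_singleton_le_iff_mem I).2 hx)]
  calc I.spanFinrank = (Ideal.span (insert x t)).spanFinrank := by rw [hI]
    _ ≤ (insert x t).ncard :=
        Submodule.spanFinrank_span_le_ncard_of_finite ((s.finite_toSet.image _).insert x)
    _ ≤ t.ncard + 1 := Set.ncard_insert_le x t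
    _ ≤ s.card + 1 := by
        rw [← Set.ncard_coe_finset]
        exact Nat.add_le_add_right (Set.ncard_image_le s.finite_toSet) 1
    _ = (I.map π).spanFinrank + 1 := by rw [hcard]

theorem isRegularLocalRing_of_quotient_span_singleton {B : Type*} [CommRing B] [IsLocalRing B]
    [IsNoetherianRing B] {x : B} (hx : x ∈ maximalIdeal B) (hx' : x ∈ nonZeroDivisors B)
    (h : IsRegularLocalRing (B ⧸ Ideal.span {x})) : IsRegularLocalRing B := by
  have hmap : (maximalIdeal B).map (Ideal.Quotient.mk (Ideal.span {x})) =
      maximalIdeal (B ⧸ Ideal.span {x}) :=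
    IsLocalRing.map_maximalIdeal_of_surjective _ Ideal.Quotient.mk_surjective
  have hrank := spanFinrank_le_spanFinrank_map_mk_add_one hx
    ((maximalIdeal B).fg_of_isNoetherianRing.map _)
  rw [hmap] at hrank
  refine IsRegularLocalRing.of_spanFinrank_maximalIdeal_le B ?_
  calc ((maximalIdeal B).spanFinrank : WithBot ℕ∞)
      ≤ (maximalIdeal (B ⧸ Ideal.span {x})).spanFinrank + 1 := by exact_mod_cast hrank
    _ = ringKrullDim (B ⧸ Ideal.span {x}) + 1 := by
        rw [IsRegularLocalRing.spanFinrank_maximalIdeal]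
    _ ≤ ringKrullDim B := ringKrullDim_quotient_succ_le_of_nonZeroDivisor hx'

theorem isRegularLocalRing_localization_of_quotient {C B : Type*} [CommRing C] [IsDomain C]
    [IsNoetherianRing C] {x : C} (hx : x ≠ 0) (hreg : IsRegularRing (C ⧸ Ideal.span {x}))
    (P : Ideal C) [P.IsPrime] (hxP : x ∈ P) [CommRing B] [Algebra C B]
    [IsLocalization.AtPrime B P] : IsRegularLocalRing B := by
  have : IsLocalRing B := IsLocalization.AtPrime.isLocalRing B P
  have : IsNoetherianRing B := IsLocalization.isNoetherianRing P.primeCompl B inferInstance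
  have : IsDomain B := IsLocalization.isDomain_of_le_nonZeroDivisors B
    P.primeCompl_le_nonZeroDivisors
  let π := Ideal.Quotient.mk (Ideal.span {x})
  have hle : Ideal.span {x} ≤ P := (Ideal.span_singleton_le_iff_mem _).2 hxP
  have : (P.map π).IsPrime := Ideal.map_isPrime_of_surjective Ideal.Quotient.mk_surjective
    (by rwa [Ideal.mk_ker])
  have : (P.map π).LiesOver P := ⟨by
    rw [Ideal.under_def, Ideal.Quotient.algebraMap_eq, Ideal.comap_map_of_surjective' _
      Ideal.Quotient.mk_surjective, Ideal.mk_ker, sup_eq_left.2 hle]⟩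
  have : IsLocalization (P.map π).primeCompl (B ⧸ (Ideal.span {x}).map (algebraMap C B)) := by
    rw [← Ideal.algebraMapSubmonoid_primeCompl_of_liesOver_surjective (P.map π) P
      Ideal.Quotient.mk_surjective]
    infer_instance
  have : IsRegularLocalRing (B ⧸ (Ideal.span {x}).map (algebraMap C B)) :=
    IsRegularLocalRing.of_ringEquiv (IsLocalization.algEquiv (P.map π).primeCompl
      (Localization.AtPrime (P.map π)) _).toRingEquiv
  have hx0 : algebraMap C B x ≠ 0 := by
    rwa [Ne, IsLocalization.to_map_eq_zero_iff B P.primeCompl_le_nonZeroDivisors]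
  refine isRegularLocalRing_of_quotient_span_singleton
    ((IsLocalization.AtPrime.to_map_mem_maximal_iff B P x).2 hxP)
    (mem_nonZeroDivisors_of_ne_zero hx0) ?_
  rwa [Ideal.map_span, Set.image_singleton] at this

end RegularQuotient

section Dehomogenization

variable {σ R : Type*} [CommRing R]

/-- Substituting `1` for the variable `X none`. -/
def dehomogenize : MvPolynomial (Option σ) R →ₐ[R] MvPolynomial σ R :=
  MvPolynomial.aeval fun o => o.elim 1 MvPolynomial.X

theorem dehomogenize_rename_some (F : MvPolynomial σ R) :
    dehomogenize (F.rename some) = F := by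
  rw [dehomogenize, MvPolynomial.aeval_rename]
  exact MvPolynomial.aeval_X_left_apply F

theorem map_dehomogenize {k : Type*} [CommRing k] (φ : R →+* k) (H : MvPolynomial (Option σ) R) :
    (dehomogenize H).map φ = dehomogenize (H.map φ) := by
  induction H using MvPolynomial.induction_on with
  | C a => simp [dehomogenize]
  | add F G hF hG => simp only [map_add, hF, hG]
  | mul_X F o hF =>
    cases o <;> simp only [map_mul, hF] <;> simp [dehomogenize]

theorem exists_isHomogeneous_dehomogenize_eq {F : MvPolynomial σ R} {N : ℕ}
    (hN : F.totalDegree ≤ N) :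
    ∃ H : MvPolynomial (Option σ) R, H.IsHomogeneous N ∧ dehomogenize H = F := by
  refine ⟨∑ i ∈ Finset.range (N + 1), (F.homogeneousComponent i).rename some *
    MvPolynomial.X none ^ (N - i), .sum _ _ _ fun i hi => ?_, ?_⟩
  · have := (F.homogeneousComponent_isHomogeneous i).rename_isHomogeneous (f := some) |>.mul
      ((MvPolynomial.isHomogeneous_X R none).pow (N - i))
    rwa [one_mul, Nat.add_sub_cancel' (Finset.mem_range_succ_iff.1 hi)] at this
  · have hX : dehomogenize (MvPolynomial.X none : MvPolynomial (Option σ) R) = 1 := by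
      simp [dehomogenize]
    simp only [map_sum, map_mul, map_pow, dehomogenize_rename_some, hX, one_pow, mul_one]
    rw [← Finset.sum_subset (Finset.range_mono (Nat.succ_le_succ hN)) fun i _ hi =>
      MvPolynomial.homogeneousComponent_eq_zero _ _ (by simpa using hi)]
    exact F.sum_homogeneousComponent

theorem algebraMap_eval_eq_pow_mul_aeval_dehomogenize {K : Type*} [Field K] [Algebra R K]
    {x : Option σ → R} (hx : algebraMap R K (x none) ≠ 0) {H : MvPolynomial (Option σ) R} {N : ℕ}
    (hH : H.IsHomogeneous N) :
    algebraMap R K (H.eval x) = algebraMap R K (x none) ^ N *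
      MvPolynomial.aeval (fun i => algebraMap R K (x (some i)) / algebraMap R K (x none))
        (dehomogenize H) := by
  have hvalue := MvPolynomial.eval₂_comp_left (algebraMap R K) (RingHom.id R) x H
  rw [MvPolynomial.eval₂_id, RingHom.comp_id] at hvalue
  have hscale : algebraMap R K ∘ x =
      fun o => algebraMap R K (x none) * (algebraMap R K (x o) / algebraMap R K (x none)) := by
    funext o
    exact (mul_div_cancel₀ _ hx).symm
  have hdehom : MvPolynomial.aeval (fun i => algebraMap R K (x (some i)) / algebraMap R K (x none))
      (dehomogenize H) =
      H.aeval fun o => algebraMap R K (x o) / algebraMap R K (x none) := by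
    rw [dehomogenize, MvPolynomial.comp_aeval_apply]
    congr 2
    funext o
    cases o <;> simp [div_self hx]
  rw [hvalue, hscale, eval₂_mul_of_isHomogeneous hH, hdehom, MvPolynomial.aeval_def]

end Dehomogenization

section LocalSubrings

variable {K : Type*} [Field K]

theorem mem_maximalIdeal_iff_of_le {A B : LocalSubring K} (h : A ≤ B) {a : K}
    (ha : a ∈ A.toSubring) :
    (⟨a, ha⟩ : A.toSubring) ∈ maximalIdeal A.toSubring ↔
      (⟨a, h.1 ha⟩ : B.toSubring) ∈ maximalIdeal B.toSubring := by
  have := h.2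
  exact (not_congr (isUnit_map_iff (Subring.inclusion h.1) (⟨a, ha⟩ : A.toSubring))).symm

theorem isUnit_iff_inv_mem {A : Subring K} {a : K} (ha : a ∈ A) (h0 : a ≠ 0) :
    IsUnit (⟨a, ha⟩ : A) ↔ a⁻¹ ∈ A := by
  refine ⟨fun h => ?_, fun h => .of_mul_eq_one ⟨a⁻¹, h⟩ (Subtype.ext (mul_inv_cancel₀ h0))⟩
  obtain ⟨b, hb⟩ := h.exists_left_inv
  rw [← eq_inv_of_mul_eq_one_left (congrArg Subtype.val hb : (b : K) * a = 1)]
  exact b.2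

theorem mem_maximalIdeal_iff_inv_notMem {A : LocalSubring K} {a : K} (ha : a ∈ A.toSubring)
    (h0 : a ≠ 0) : (⟨a, ha⟩ : A.toSubring) ∈ maximalIdeal A.toSubring ↔ a⁻¹ ∉ A.toSubring := by
  rw [mem_maximalIdeal, mem_nonunits_iff, isUnit_iff_inv_mem ha h0]

theorem le_iff_inv_mem {A B : LocalSubring K} :
    A ≤ B ↔ A.toSubring ≤ B.toSubring ∧ ∀ a ∈ A.toSubring, a ≠ 0 → a⁻¹ ∈ B.toSubring →
      a⁻¹ ∈ A.toSubring := by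
  constructor
  · intro h
    refine ⟨h.1, fun a ha h0 hi => ?_⟩
    by_contra hn
    exact (mem_maximalIdeal_iff_inv_notMem (h.1 ha) h0).1
      ((mem_maximalIdeal_iff_of_le h ha).1 ((mem_maximalIdeal_iff_inv_notMem ha h0).2 hn)) hi
  · rintro ⟨h, H⟩
    refine ⟨h, ⟨fun a ha => ?_⟩⟩
    have h0 : (a : K) ≠ 0 := fun h0 => ha.ne_zero (Subtype.ext h0)
    exact (isUnit_iff_inv_mem a.2 h0).2 (H a a.2 h0 ((isUnit_iff_inv_mem (h a.2) h0).1 ha))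

theorem ne_zero_of_notMem {C : Subring K} {P : Ideal C} {s : C} (hs : s ∉ P) : (s : K) ≠ 0 :=
  fun h0 => hs ((Subtype.ext h0 : s = 0) ▸ P.zero_mem)

theorem mem_ofPrime_iff {A : Subring K} {P : Ideal A} [P.IsPrime] {k : K} :
    k ∈ (LocalSubring.ofPrime A P).toSubring ↔ ∃ a s : A, s ∉ P ∧ k = a / s := by
  constructor
  · intro hk
    obtain ⟨a, s, has⟩ := IsLocalization.exists_mk'_eq P.primeCompl
      (⟨k, hk⟩ : (LocalSubring.ofPrime A P).toSubring)
    rw [IsLocalization.mk'_eq_iff_eq_mul] at has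
    exact ⟨a, s, s.2, (eq_div_iff (ne_zero_of_notMem s.2)).2 (congrArg Subtype.val has).symm⟩
  · rintro ⟨a, s, hs, rfl⟩
    let w := IsLocalization.mk' (LocalSubring.ofPrime A P).toSubring a (⟨s, hs⟩ : P.primeCompl)
    have hw : w * algebraMap A _ s = algebraMap A _ a := IsLocalization.mk'_spec _ a ⟨s, hs⟩
    have : (a : K) / s = w := (div_eq_iff (ne_zero_of_notMem hs)).2 (congrArg Subtype.val hw).symm
    exact this ▸ w.2

theorem div_mem_of_mem_span {A B : Subring K} (hAB : A ≤ B) {x : K} {s : Set A}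
    (hs : ∀ y ∈ s, (y : K) / x ∈ B) {y : A} (hy : y ∈ Ideal.span s) : (y : K) / x ∈ B := by
  induction hy using Submodule.span_induction with
  | mem y hy => exact hs y hy
  | zero => simp
  | add y z _ _ hy hz => simpa only [Subring.coe_add, add_div] using B.add_mem hy hz
  | smul a y _ hy => exact (mul_div_assoc (a : K) y x).symm ▸ B.mul_mem (hAB a.2) hy

theorem algebraMap_div_pow_mem {A : Type*} [CommRing A] [Algebra A K] {B : Subring K}
    (hAB : ∀ a, algebraMap A K a ∈ B) {x : K} {I : Ideal A}
    (hI : ∀ y ∈ I, algebraMap A K y / x ∈ B) {n : ℕ} {f : A} (hf : f ∈ I ^ n) :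
    algebraMap A K f / x ^ n ∈ B := by
  induction n generalizing f with
  | zero => simpa using hAB f
  | succ n ih =>
    rw [pow_succ] at hf
    refine Submodule.mul_induction_on hf (fun g hg y hy => ?_) fun y z hy hz => ?_
    · simpa only [map_mul, pow_succ, mul_div_mul_comm] using B.mul_mem (ih hg) (hI y hy)
    · simpa only [map_add, add_div] using B.add_mem hy hz

theorem le_quadraticChart (T : LocalSubring K) (x : T.toSubring) :
    T.toSubring ≤ quadraticChart T x := fun _ ha => Subring.subset_closure (Or.inl ha)

theorem div_mem_quadraticChart {T : LocalSubring K} {x y : T.toSubring}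
    (hy : y ∈ maximalIdeal T.toSubring) : (y : K) / x ∈ quadraticChart T x :=
  Subring.subset_closure (Or.inr ⟨y, hy, rfl⟩)

theorem quadraticChart_le {T : LocalSubring K} {x : T.toSubring} {B : Subring K}
    (hTB : T.toSubring ≤ B) (hx : ∀ y ∈ maximalIdeal T.toSubring, (y : K) / x ∈ B) :
    quadraticChart T x ≤ B := by
  rw [quadraticChart, Subring.closure_le]
  rintro k (hk | ⟨y, hy, rfl⟩)
  · exact hTB hk
  · exact hx y hy

end LocalSubrings

section Chart

variable {K σ : Type*} [Field K] {T : LocalSubring K} {x : Option σ → T.toSubring}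

/-- The parameter `x₀` as an element of the chart `T[𝔪/x₀]`, where it generates the extension
of `𝔪`. -/
def chartElem (T : LocalSubring K) (x₀ : T.toSubring) : quadraticChart T x₀ :=
  ⟨x₀, le_quadraticChart T x₀ x₀.2⟩

/-- The homomorphism `T[Xᵢ] → T[𝔪/x₀]`, `Xᵢ ↦ xᵢ/x₀`, where `x₀ = x none` and the `xᵢ`, `i : σ`,
are the other parameters. -/
def chartEval (hx : IsRegularParameters x) :
    MvPolynomial σ T.toSubring →+* quadraticChart T (x none) :=
  MvPolynomial.eval₂Hom (Subring.inclusion (le_quadraticChart T _)) fun i =>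
    ⟨x (some i) / x none, div_mem_quadraticChart (hx.mem_maximalIdeal _)⟩

theorem coe_chartEval (hx : IsRegularParameters x) (F : MvPolynomial σ T.toSubring) :
    (chartEval hx F : K) = F.aeval fun i => (x (some i) : K) / x none :=
  MvPolynomial.eval₂_comp_left (quadraticChart T (x none)).subtype _ _ F

variable [Finite σ] [IsNoetherianRing T.toSubring]

theorem chartEval_surjective (hx : IsRegularParameters x) :
    Function.Surjective (chartEval hx) := by
  have hle : quadraticChart T (x none) ≤
      ((quadraticChart T (x none)).subtype.comp (chartEval hx)).range := by
    have hT : T.toSubring ≤ ((quadraticChart T (x none)).subtype.comp (chartEval hx)).range :=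
      fun t ht => ⟨MvPolynomial.C ⟨t, ht⟩, by simp [chartEval]⟩
    refine quadraticChart_le hT fun y hy => div_mem_of_mem_span hT ?_ (hx.span_range ▸ hy)
    rintro _ ⟨_ | i, rfl⟩
    · rw [div_self fun h => hx.ne_zero none (Subtype.ext h)]
      exact one_mem _
    · exact ⟨MvPolynomial.X i, by simp [chartEval]⟩
  intro c
  obtain ⟨F, hF⟩ := hle c.2
  exact ⟨F, Subtype.ext hF⟩

theorem exists_homogenization (hx : IsRegularParameters x) {F : MvPolynomial σ T.toSubring} {N : ℕ}
    (hN : F.totalDegree ≤ N) : ∃ H : MvPolynomial (Option σ) T.toSubring, H.IsHomogeneous N ∧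
      dehomogenize H = F ∧ (H.eval x : K) = chartEval hx F * (x none : K) ^ N := by
  obtain ⟨H, hH, hHF⟩ := exists_isHomogeneous_dehomogenize_eq hN
  refine ⟨H, hH, hHF, ?_⟩
  rw [coe_chartEval, ← hHF, mul_comm]
  exact algebraMap_eval_eq_pow_mul_aeval_dehomogenize
    (fun h => hx.ne_zero none (Subtype.ext h)) hH

theorem exists_mem_pow_eq_mul_pow (hx : IsRegularParameters x) (c : quadraticChart T (x none)) :
    ∃ M : ℕ, ∀ N, M ≤ N → ∃ t ∈ maximalIdeal T.toSubring ^ N, (t : K) = c * (x none : K) ^ N := by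
  obtain ⟨F, rfl⟩ := chartEval_surjective hx c
  refine ⟨F.totalDegree, fun N hN => ?_⟩
  obtain ⟨H, hH, -, hval⟩ := exists_homogenization hx hN
  exact ⟨H.eval x, hx.mem_pow_iff.2 ⟨H, hH, rfl⟩, hval⟩

theorem chartElem_dvd_iff (hx : IsRegularParameters x) {c : quadraticChart T (x none)} {N : ℕ}
    {t : T.toSubring} (ht : t ∈ maximalIdeal T.toSubring ^ N)
    (htc : (t : K) = c * (x none : K) ^ N) :
    chartElem T (x none) ∣ c ↔ t ∈ maximalIdeal T.toSubring ^ (N + 1) := by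
  have hx₀ : (x none : K) ≠ 0 := fun h => hx.ne_zero none (Subtype.ext h)
  constructor
  · rintro ⟨c', rfl⟩
    obtain ⟨M, hM⟩ := exists_mem_pow_eq_mul_pow hx c'
    obtain ⟨t', ht', htc'⟩ := hM M le_rfl
    have hmul : t * x none ^ M = x none ^ (N + 1) * t' := by
      refine Subtype.ext ?_
      push_cast
      rw [htc, htc', Subring.coe_mul, chartElem]
      ring
    refine hx.mem_pow_succ_of_mul_pow_mem ht (j := none) (m := M) ?_
    rw [hmul, add_right_comm, pow_add]
    exact Ideal.mul_mem_mul (Ideal.pow_mem_pow (hx.mem_maximalIdeal none) _) ht'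
  · intro ht'
    refine ⟨⟨_, algebraMap_div_pow_mem (fun a => le_quadraticChart T (x none) a.2)
      (fun y => div_mem_quadraticChart) ht'⟩, Subtype.ext ?_⟩
    refine mul_right_cancel₀ (pow_ne_zero N hx₀) (htc.symm.trans ?_)
    rw [Subring.coe_mul, chartElem, mul_right_comm, ← pow_succ',
      mul_div_cancel₀ _ (pow_ne_zero _ hx₀)]
    rfl

theorem map_residue_eq_zero_of_chartElem_dvd (hx : IsRegularParameters x)
    {F : MvPolynomial σ T.toSubring} (h : chartElem T (x none) ∣ chartEval hx F) :
    F.map (residue T.toSubring) = 0 := by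
  obtain ⟨H, hH, rfl, hval⟩ := exists_homogenization hx (le_refl F.totalDegree)
  have ht := (chartElem_dvd_iff hx (hx.mem_pow_iff.2 ⟨H, hH, rfl⟩) hval).1 h
  rw [map_dehomogenize, (hx.eval_mem_pow_succ_iff hH).1 ht, map_zero]

theorem ker_mk_comp_chartEval (hx : IsRegularParameters x) :
    RingHom.ker ((Ideal.Quotient.mk (Ideal.span {chartElem T (x none)})).comp (chartEval hx)) =
      RingHom.ker (MvPolynomial.map (σ := σ) (residue T.toSubring)) := by
  apply le_antisymm
  · intro F hF
    rw [RingHom.mem_ker, RingHom.comp_apply, Ideal.Quotient.eq_zero_iff_dvd] at hF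
    exact map_residue_eq_zero_of_chartElem_dvd hx hF
  · rw [MvPolynomial.ker_map, ker_residue, Ideal.map_le_iff_le_comap]
    intro t ht
    rw [Ideal.mem_comap, RingHom.mem_ker, RingHom.comp_apply, Ideal.Quotient.eq_zero_iff_dvd]
    refine ⟨⟨(t : K) / x none, div_mem_quadraticChart ht⟩, Subtype.ext ?_⟩
    rw [coe_chartEval, MvPolynomial.aeval_C]
    exact (mul_div_cancel₀ (t : K) fun h => hx.ne_zero none (Subtype.ext h)).symm

/-- The exceptional divisor of the blowup of the closed point, in the chart `T[𝔪/x₀]`, is an affine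
space over the residue field of `T`. -/
def chartQuotientEquiv (hx : IsRegularParameters x) :
    MvPolynomial σ (ResidueField T.toSubring) ≃+*
      (quadraticChart T (x none) ⧸ Ideal.span {chartElem T (x none)}) :=
  (RingHom.quotientKerEquivOfSurjective
    (MvPolynomial.map_surjective _ residue_surjective)).symm.trans <|
  (Ideal.quotEquivOfEq (ker_mk_comp_chartEval hx).symm).trans <|
  RingHom.quotientKerEquivOfSurjective
    (Ideal.Quotient.mk_surjective.comp (chartEval_surjective hx))

theorem isNoetherianRing_quadraticChart (hx : IsRegularParameters x) :
    IsNoetherianRing (quadraticChart T (x none)) :=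
  isNoetherianRing_of_surjective _ _ _ (chartEval_surjective hx)

theorem chartElem_prime (hx : IsRegularParameters x) : Prime (chartElem T (x none)) := by
  rw [← Ideal.span_singleton_prime, ← Ideal.Quotient.isDomain_iff_prime]
  · exact MulEquiv.isDomain _ (chartQuotientEquiv hx).symm.toMulEquiv
  · exact fun h => hx.ne_zero none
      (Subtype.ext (congrArg (fun z : quadraticChart T (x none) => (z : K)) h))

theorem isRegularLocalRing_ofPrime_quadraticChart (hx : IsRegularParameters x)
    (P : Ideal (quadraticChart T (x none))) [P.IsPrime] (hP : chartElem T (x none) ∈ P) :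
    IsRegularLocalRing (LocalSubring.ofPrime (quadraticChart T (x none)) P).toSubring := by
  have := isNoetherianRing_quadraticChart hx
  exact isRegularLocalRing_localization_of_quotient (chartElem_prime hx).ne_zero
    (IsRegularRing.of_ringEquiv (chartQuotientEquiv hx)) P hP

end Chart

section Order

variable {A : Type*} [CommRing A] [IsLocalRing A]

theorem natCast_le_ord_iff {f : A} {n : ℕ} : (n : ℕ∞) ≤ ord A f ↔ f ∈ maximalIdeal A ^ n := by
  refine ⟨fun h => ?_, fun h => le_iSup₂_of_le n h le_rfl⟩
  by_contra hf
  have hlt : ∀ k, f ∈ maximalIdeal A ^ k → k < n := fun k hk =>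
    not_le.1 fun hnk => hf (Ideal.pow_le_pow_right hnk hk)
  have hle : ord A f ≤ (n - 1 : ℕ) :=
    iSup₂_le fun k hk => Nat.cast_le.2 (Nat.le_sub_one_of_lt (hlt k hk))
  have hn := hlt 0 (by simp)
  have := Nat.cast_le.1 (h.trans hle)
  omega

theorem ord_le_natCast {f : A} {n : ℕ} (hf : f ∉ maximalIdeal A ^ (n + 1)) : ord A f ≤ n := by
  rw [← natCast_le_ord_iff, not_le, Nat.cast_succ] at hf
  exact Order.le_of_lt_add_one hf

theorem eq_top_of_isPrincipal_of_maximalIdeal_le_radical [IsNoetherianRing A]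
    (hdim : 2 ≤ ringKrullDim A) {P : Ideal A} (hP : P.IsPrincipal)
    (h : maximalIdeal A ≤ P.radical) : P = ⊤ := by
  by_contra hne
  have hmin : maximalIdeal A ∈ P.minimalPrimes :=
    ⟨⟨inferInstance, le_maximalIdeal hne⟩, fun Q hQ _ => h.trans (hQ.1.radical_le_iff.2 hQ.2)⟩
  rw [← maximalIdeal_height_eq_ringKrullDim] at hdim
  exact absurd ((WithBot.coe_le_coe.1 hdim : (2 : ℕ∞) ≤ _).trans
    (Ideal.height_le_one_of_isPrincipal_of_mem_minimalPrimes _ _ hmin)) (by decide)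

end Order

section Domination

variable {K : Type*} [Field K]

theorem inv_mem_of_mem_of_le {A B : LocalSubring K} (h : A ≤ B) {a : K} (ha : a ∈ A.toSubring)
    (hi : a⁻¹ ∈ B.toSubring) : a⁻¹ ∈ A.toSubring := by
  rcases eq_or_ne a 0 with rfl | h0
  · simp
  · exact (le_iff_inv_mem.1 h).2 a ha h0 hi

theorem le_of_toSubring_le {A B D : LocalSubring K} (hAD : A ≤ D) (hBD : B ≤ D)
    (h : A.toSubring ≤ B.toSubring) : A ≤ B :=
  le_iff_inv_mem.2 ⟨h, fun _ ha _ hi => inv_mem_of_mem_of_le hAD ha (hBD.1 hi)⟩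

variable {C : Subring K}

theorem inv_mem_ofPrime {P : Ideal C} [P.IsPrime] {s : C} (hs : s ∉ P) :
    (s : K)⁻¹ ∈ (LocalSubring.ofPrime C P).toSubring :=
  mem_ofPrime_iff.2 ⟨1, s, hs, by simp⟩

theorem ofPrime_comap_le {D : LocalSubring K} (hCD : C ≤ D.toSubring) :
    LocalSubring.ofPrime C ((maximalIdeal D.toSubring).comap (Subring.inclusion hCD)) ≤ D := by
  set P := (maximalIdeal D.toSubring).comap (Subring.inclusion hCD)
  have hinv : ∀ s ∉ P, (s : K)⁻¹ ∈ D.toSubring := fun s hs =>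
    not_not.1 fun h => hs ((mem_maximalIdeal_iff_inv_notMem (hCD s.2) (ne_zero_of_notMem hs)).2 h)
  rw [le_iff_inv_mem]
  constructor
  · rintro k hk
    obtain ⟨a, s, hs, rfl⟩ := mem_ofPrime_iff.1 hk
    rw [div_eq_mul_inv]
    exact mul_mem (hCD a.2) (hinv s hs)
  · intro k hk hk0 hkD
    obtain ⟨a, s, hs, rfl⟩ := mem_ofPrime_iff.1 hk
    have ha0 : (a : K) ≠ 0 := (div_ne_zero_iff.1 hk0).1
    refine mem_ofPrime_iff.2 ⟨s, a, fun ha => ?_, inv_div _ _⟩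
    refine (mem_maximalIdeal_iff_inv_notMem (hCD a.2) ha0).1 ha ?_
    have : (a : K)⁻¹ = (a / s : K)⁻¹ * (s : K)⁻¹ := by
      rw [← mul_inv, div_mul_cancel₀ _ (ne_zero_of_notMem hs)]
    exact this ▸ mul_mem hkD (hinv s hs)

theorem prime_inclusion_ofPrime {P : Ideal C} [P.IsPrime] {c : C} (hc : Prime c) (hcP : c ∈ P) :
    Prime (Subring.inclusion (LocalSubring.le_ofPrime C P) c) := by
  have hprime : (Ideal.span {c}).IsPrime := (Ideal.span_singleton_prime hc.ne_zero).2 hc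
  have hdisj : Disjoint (P.primeCompl : Set C) (Ideal.span {c} : Set C) :=
    Set.disjoint_left.2 fun s hs hs' => hs ((Ideal.span_singleton_le_iff_mem _).2 hcP hs')
  have := IsLocalization.isPrime_of_isPrime_disjoint P.primeCompl
    (LocalSubring.ofPrime C P).toSubring _ hprime hdisj
  rw [Ideal.map_span, Set.image_singleton, Ideal.span_singleton_prime] at this
  · exact this
  · exact (map_ne_zero_iff _ (Subring.inclusion_injective _)).2 hc.ne_zero

theorem two_le_height_of_bot_lt_of_lt {A : Type*} [CommRing A] [IsDomain A] {Q P : Ideal A}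
    [Q.IsPrime] [P.IsPrime] (hQ : ⊥ < Q) (hQP : Q < P) : 2 ≤ P.height :=
  calc (2 : ℕ∞) = 0 + 1 + 1 := by norm_num
    _ ≤ (⊥ : Ideal A).height + 1 + 1 := by gcongr; exact zero_le
    _ ≤ Q.height + 1 := by gcongr; exact Ideal.height_add_one_le_of_lt_of_isPrime hQ
    _ ≤ P.height := Ideal.height_add_one_le_of_lt_of_isPrime hQP

end Domination

section Center

variable {K : Type*} [Field K]

/-- The maximal ideal of `T` extends to a principal ideal of `D`, generated by an element of it. -/
def MaximalIdealBecomesPrincipal (T D : LocalSubring K) : Prop :=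
  ∃ x ∈ maximalIdeal T.toSubring, x ≠ 0 ∧
    ∀ y ∈ maximalIdeal T.toSubring, (y : K) / x ∈ D.toSubring

/-- `T'` is a local quadratic transform of the local ring `T`, regular, in which the maximal ideal
of `T` is generated by the prime element `x` of `T'`. The field `exists_associated` says that `T'`
is `T[1/x]` localized, up to powers of `x`. -/
structure IsQuadraticCenter (T : LocalSubring K) (x : T.toSubring) (T' : LocalSubring K) :
    Prop where
  mem : x ∈ maximalIdeal T.toSubring
  transform : IsLocalQuadraticTransform T T'
  regular : IsRegularLocalRing T'.toSubring
  div_mem : ∀ y ∈ maximalIdeal T.toSubring, (y : K) / x ∈ T'.toSubring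
  prime : Prime (Subring.inclusion transform.2.1 x)
  exists_associated : ∀ b : T'.toSubring, ∃ (a t : T.toSubring) (n : ℕ),
    Subring.inclusion transform.2.1 a = b * Subring.inclusion transform.2.1 t ∧
      Associated (Subring.inclusion transform.2.1 t) (Subring.inclusion transform.2.1 x ^ n)
  eq_ord : ringKrullDim T'.toSubring < 2 → (T'.toSubring : Set K) = ordValuationRing T

variable {T : LocalSubring K}

theorem IsQuadraticCenter.lt [IsNoetherianRing T.toSubring]
    (hdim : 2 ≤ ringKrullDim T.toSubring) {x : T.toSubring} {T' : LocalSubring K}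
    (h : IsQuadraticCenter T x T') : T < T' := by
  refine lt_of_le_of_ne h.transform.2 ?_
  rintro rfl
  have hx0 : (x : K) ≠ 0 := fun h0 => h.prime.ne_zero (Subtype.ext h0)
  have hm : maximalIdeal T.toSubring ≤ Ideal.span {x} := fun y hy =>
    Ideal.mem_span_singleton.2
      ⟨⟨_, h.div_mem y hy⟩, Subtype.ext (mul_div_cancel₀ (y : K) hx0).symm⟩
  have htop := eq_top_of_isPrincipal_of_maximalIdeal_le_radical hdim ⟨⟨x, rfl⟩⟩
    (hm.trans Ideal.le_radical)
  exact h.mem (Ideal.span_singleton_eq_top.1 htop)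

theorem notMem_sq_of_div_mem {D : LocalSubring K} (hTD : T ≤ D) {x : T.toSubring} (hx0 : x ≠ 0)
    (hdiv : ∀ y ∈ maximalIdeal T.toSubring, (y : K) / x ∈ D.toSubring) :
    x ∉ maximalIdeal T.toSubring ^ 2 := by
  have hx0' : (x : K) ≠ 0 := fun h => hx0 (Subtype.ext h)
  have key : ∀ f ∈ maximalIdeal T.toSubring ^ 2, ∃ g ∈ maximalIdeal D.toSubring,
      (g : K) = f / x := by
    intro f hf
    rw [pow_two] at hf
    refine Submodule.mul_induction_on hf (fun a ha b hb => ?_) ?_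
    · refine ⟨⟨a / x, hdiv a ha⟩ * ⟨b, hTD.1 b.2⟩,
        Ideal.mul_mem_left _ _ ((mem_maximalIdeal_iff_of_le hTD b.2).1 hb), ?_⟩
      exact div_mul_eq_mul_div _ _ _
    · rintro a b ⟨g, hg, hga⟩ ⟨h, hh, hhb⟩
      exact ⟨g + h, Ideal.add_mem _ hg hh, by simp [hga, hhb, add_div]⟩
  intro hx2
  obtain ⟨g, hg, hgx⟩ := key x hx2
  rw [div_self hx0'] at hgx
  exact (Ideal.ne_top_iff_one _).1 (maximalIdeal.isMaximal D.toSubring).ne_top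
    ((Subtype.ext hgx : g = 1) ▸ hg)

section Parameters

variable {σ : Type*} [Finite σ] [IsNoetherianRing T.toSubring] {x : Option σ → T.toSubring}

theorem exists_eq_mul_associated (hx : IsRegularParameters x)
    {P : Ideal (quadraticChart T (x none))} [P.IsPrime]
    (hT : T.toSubring ≤ (LocalSubring.ofPrime (quadraticChart T (x none)) P).toSubring)
    (b : (LocalSubring.ofPrime (quadraticChart T (x none)) P).toSubring) :
    ∃ (a t : T.toSubring) (n : ℕ), Subring.inclusion hT a = b * Subring.inclusion hT t ∧
      Associated (Subring.inclusion hT t) (Subring.inclusion hT (x none) ^ n) := by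
  obtain ⟨c, s, hs, hb⟩ := mem_ofPrime_iff.1 b.2
  obtain ⟨M₁, h₁⟩ := exists_mem_pow_eq_mul_pow hx c
  obtain ⟨M₂, h₂⟩ := exists_mem_pow_eq_mul_pow hx s
  obtain ⟨a, -, ha⟩ := h₁ _ (le_max_left M₁ M₂)
  obtain ⟨t, -, ht⟩ := h₂ _ (le_max_right M₁ M₂)
  have hunit := (isUnit_iff_inv_mem (LocalSubring.le_ofPrime _ P s.2) (ne_zero_of_notMem hs)).2
    (inv_mem_ofPrime hs)
  refine ⟨a, t, max M₁ M₂, Subtype.ext ?_, ?_⟩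
  · change (a : K) = b * t
    rw [ha, ht, hb, ← mul_assoc, div_mul_cancel₀ _ (ne_zero_of_notMem hs)]
  · have hts : Subring.inclusion hT t =
        Subring.inclusion (LocalSubring.le_ofPrime _ P) s *
          Subring.inclusion hT (x none) ^ max M₁ M₂ := Subtype.ext ht
    exact hts ▸ associated_unit_mul_left _ _ hunit

theorem eq_span_of_ringKrullDim_lt_two (hx : IsRegularParameters x)
    {P : Ideal (quadraticChart T (x none))} [P.IsPrime] (hP : chartElem T (x none) ∈ P)
    (hdim : ringKrullDim (LocalSubring.ofPrime (quadraticChart T (x none)) P).toSubring < 2) :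
    P = Ideal.span {chartElem T (x none)} := by
  by_contra hne
  have hprime := chartElem_prime hx
  have hX : (Ideal.span {chartElem T (x none)}).IsPrime :=
    (Ideal.span_singleton_prime hprime.ne_zero).2 hprime
  rw [IsLocalization.AtPrime.ringKrullDim_eq_height P] at hdim
  refine (WithBot.coe_lt_coe.1 hdim).not_ge (two_le_height_of_bot_lt_of_lt
    (Q := Ideal.span {chartElem T (x none)}) ?_ ?_)
  · exact bot_lt_iff_ne_bot.2 (Ideal.span_singleton_eq_bot.not.2 hprime.ne_zero)
  · exact lt_of_le_of_ne ((Ideal.span_singleton_le_iff_mem _).2 hP) (Ne.symm hne)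

theorem ofPrime_eq_ordValuationRing (hx : IsRegularParameters x)
    {P : Ideal (quadraticChart T (x none))} [P.IsPrime]
    (hP : P = Ideal.span {chartElem T (x none)}) :
    ((LocalSubring.ofPrime (quadraticChart T (x none)) P).toSubring : Set K) =
      ordValuationRing T := by
  have hx₀ : (x none : K) ≠ 0 := fun h => hx.ne_zero none (Subtype.ext h)
  ext k
  rw [SetLike.mem_coe, mem_ofPrime_iff]
  constructor
  · rintro ⟨c, s, hs, rfl⟩
    obtain ⟨M₁, h₁⟩ := exists_mem_pow_eq_mul_pow hx c
    obtain ⟨M₂, h₂⟩ := exists_mem_pow_eq_mul_pow hx s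
    obtain ⟨t, ht, htc⟩ := h₁ _ (le_max_left M₁ M₂)
    obtain ⟨u, hu, hus⟩ := h₂ _ (le_max_right M₁ M₂)
    rw [hP, Ideal.mem_span_singleton, chartElem_dvd_iff hx hu hus] at hs
    refine ⟨t, u, ?_, (ord_le_natCast hs).trans (natCast_le_ord_iff.2 ht), ?_⟩
    · rintro rfl
      exact hs (Ideal.zero_mem _)
    · rw [htc, hus, mul_div_mul_right _ _ (pow_ne_zero _ hx₀)]
  · rintro ⟨f, g, hg, hfg, rfl⟩
    obtain ⟨m, hm, hm'⟩ := exists_mem_pow_notMem_pow_succ hg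
    have hf : f ∈ maximalIdeal T.toSubring ^ m :=
      natCast_le_ord_iff.1 ((natCast_le_ord_iff.2 hm).trans hfg)
    have hdiv : ∀ f ∈ maximalIdeal T.toSubring ^ m,
        (f : K) / (x none : K) ^ m ∈ quadraticChart T (x none) := fun f =>
      algebraMap_div_pow_mem (fun a => le_quadraticChart T (x none) a.2)
        fun y => div_mem_quadraticChart
    refine ⟨⟨_, hdiv f hf⟩, ⟨_, hdiv g hm⟩, ?_,
      (div_div_div_cancel_right₀ (pow_ne_zero _ hx₀) _ _).symm⟩
    rwa [hP, Ideal.mem_span_singleton,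
      chartElem_dvd_iff hx hm (div_mul_cancel₀ _ (pow_ne_zero _ hx₀)).symm]

theorem isQuadraticCenter_ofPrime (hx : IsRegularParameters x)
    {P : Ideal (quadraticChart T (x none))} [P.IsPrime] (hP : chartElem T (x none) ∈ P)
    (hT : T ≤ LocalSubring.ofPrime (quadraticChart T (x none)) P) :
    IsQuadraticCenter T (x none) (LocalSubring.ofPrime (quadraticChart T (x none)) P) := by
  have hprime : Prime (Subring.inclusion (LocalSubring.le_ofPrime _ P)
      (chartElem T (x none))) := prime_inclusion_ofPrime (chartElem_prime hx) hP
  exact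
    { mem := hx.mem_maximalIdeal none
      transform := ⟨⟨x none, hx.mem_maximalIdeal none, hx.ne_zero none, P, ‹_›, rfl⟩, hT⟩
      regular := isRegularLocalRing_ofPrime_quadraticChart hx P hP
      div_mem := fun _ hy => LocalSubring.le_ofPrime _ P (div_mem_quadraticChart hy)
      prime := hprime
      exists_associated := exists_eq_mul_associated hx hT.1
      eq_ord := fun hdim =>
        ofPrime_eq_ordValuationRing hx (eq_span_of_ringKrullDim_lt_two hx hP hdim) }

end Parameters

theorem exists_isQuadraticCenter [IsRegularLocalRing T.toSubring] {D : LocalSubring K}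
    (hTD : T ≤ D) (h : MaximalIdealBecomesPrincipal T D) :
    ∃ (x : T.toSubring) (T' : LocalSubring K), IsQuadraticCenter T x T' ∧ T' ≤ D := by
  obtain ⟨x, hx, hx0, hdiv⟩ := h
  obtain ⟨n, y, hy, rfl⟩ :=
    exists_isRegularParameters_none_eq hx (notMem_sq_of_div_mem hTD hx0 hdiv)
  have hCD : quadraticChart T (y none) ≤ D.toSubring := quadraticChart_le hTD.1 hdiv
  have hT'D := ofPrime_comap_le (D := D) hCD
  have hTT' := le_of_toSubring_le hTD hT'D
    ((le_quadraticChart T (y none)).trans (LocalSubring.le_ofPrime _ _))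
  have hP : chartElem T (y none) ∈
      (maximalIdeal D.toSubring).comap (Subring.inclusion hCD) :=
    (mem_maximalIdeal_iff_of_le hTD (y none).2).1 hx
  exact ⟨_, _, isQuadraticCenter_ofPrime hy hP hTT', hT'D⟩

end Center

section PrimeProducts

/-- The submonoid generated by the units and the prime elements: the multiplicative substitute,
in a ring not known to be factorial, for the set of nonzero elements. -/
def primeProducts (A : Type*) [CommMonoidWithZero A] : Submonoid A :=
  Submonoid.closure {a | IsUnit a ∨ Prime a}

theorem mem_primeProducts_of_isUnit_or_prime {A : Type*} [CommMonoidWithZero A] {a : A}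
    (ha : IsUnit a ∨ Prime a) : a ∈ primeProducts A := Submonoid.subset_closure ha

theorem exists_prime_dvd_of_mem_primeProducts {A : Type*} [CommRing A] {𝔭 : Ideal A}
    [h𝔭 : 𝔭.IsPrime] {m : A} (hm : m ∈ primeProducts A) (hm𝔭 : m ∈ 𝔭) :
    ∃ p ∈ 𝔭, Prime p ∧ p ∣ m := by
  obtain ⟨s, hs, rfl⟩ := Submonoid.exists_multiset_of_mem_closure hm
  obtain ⟨p, hps, hp𝔭⟩ := (h𝔭.multiset_prod_mem_iff_exists_mem s).1 hm𝔭
  refine ⟨p, hp𝔭, (hs p hps).resolve_left fun hu => ?_, Multiset.dvd_prod hps⟩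
  exact h𝔭.ne_top (Ideal.eq_top_of_isUnit_mem _ hp𝔭 hu)

variable {A : Type*} [CommRing A] [IsDomain A]

theorem ne_zero_of_mem_primeProducts {m : A} (hm : m ∈ primeProducts A) : m ≠ 0 := by
  refine nonZeroDivisors.ne_zero ((Submonoid.closure_le.2 fun a ha => ?_ :
    primeProducts A ≤ nonZeroDivisors A) hm)
  exact mem_nonZeroDivisors_of_ne_zero (ha.elim IsUnit.ne_zero Prime.ne_zero)

theorem mem_primeProducts_of_dvd {m a : A} (hm : m ∈ primeProducts A) (h : a ∣ m) :
    a ∈ primeProducts A := by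
  obtain ⟨b, rfl⟩ := h
  exact divisor_closure_eq_closure a b hm

theorem isPrimal_of_mem_primeProducts {m : A} (hm : m ∈ primeProducts A) : IsPrimal m := by
  refine (Submonoid.closure_le.2 fun a ha => ?_ : primeProducts A ≤ Submonoid.isPrimal A) hm
  exact ha.elim IsUnit.isPrimal Prime.isPrimal

theorem exists_prime_dvd_of_dvd_mul {𝔭 : Ideal A} [h𝔭 : 𝔭.IsPrime] {m u γ : A}
    (hm : m ∈ primeProducts A) (hu : u ∉ 𝔭) (hγ : γ ∈ 𝔭) (h : γ ∣ u * m) :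
    ∃ p ∈ 𝔭, Prime p ∧ p ∣ γ := by
  obtain ⟨t, ht⟩ := h
  obtain ⟨m₁, m₂, ⟨γ', rfl⟩, ⟨t', rfl⟩, rfl⟩ :=
    isPrimal_of_mem_primeProducts hm (ht ▸ dvd_mul_left m u)
  have hut : u = γ' * t' := mul_right_cancel₀ (ne_zero_of_mem_primeProducts hm) (by rw [ht]; ring)
  have hγ' : γ' ∉ 𝔭 := fun h => hu (hut ▸ 𝔭.mul_mem_right _ h)
  obtain ⟨p, hp𝔭, hp, hpm⟩ := exists_prime_dvd_of_mem_primeProducts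
    (mem_primeProducts_of_dvd hm (dvd_mul_right m₁ m₂)) ((h𝔭.mem_or_mem hγ).resolve_right hγ')
  exact ⟨p, hp𝔭, hp, hpm.mul_right γ'⟩

theorem dvd_of_forall_dvd_mul {J : Ideal A} (hJ : ∀ p, Prime p → ¬J ≤ Ideal.span {p}) {γ a : A}
    (hγ : γ ∈ primeProducts A) (h : ∀ j ∈ J, γ ∣ a * j) : γ ∣ a := by
  induction hγ using Submonoid.closure_induction generalizing a with
  | mem γ hγ =>
    rcases hγ with hγ | hγ
    · exact hγ.dvd
    · by_contra ha
      exact hJ γ hγ fun j hj =>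
        Ideal.mem_span_singleton.2 ((hγ.dvd_or_dvd (h j hj)).resolve_left ha)
  | one => exact one_dvd a
  | mul γ₁ γ₂ h₁ _ ih₁ ih₂ =>
    obtain ⟨b, rfl⟩ := ih₁ fun j hj => (dvd_mul_right γ₁ γ₂).trans (h j hj)
    refine mul_dvd_mul_left γ₁ (ih₂ fun j hj => ?_)
    exact (mul_dvd_mul_iff_left (ne_zero_of_mem_primeProducts h₁)).1 (mul_assoc γ₁ b j ▸ h j hj)

theorem exists_isLeast_principal [WfDvdMonoid A] {L : Ideal A} {m : A}
    (hm : m ∈ primeProducts A) (hmL : m ∈ L) :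
    ∃ (a : A) (J : Ideal A), a ≠ 0 ∧
      IsLeast {P : Ideal A | P.IsPrincipal ∧ L ≤ P} (Ideal.span {a}) ∧
      Ideal.span {a} * J = L ∧ ∃ m' ∈ primeProducts A, m' ∈ J := by
  obtain ⟨m', ⟨a, rfl, haL⟩, hmin⟩ := (wellFounded_dvdNotUnit (α := A)).has_min
    {m' | ∃ a, m = a * m' ∧ L ≤ Ideal.span {a}} ⟨m, 1, (one_mul m).symm, by simp⟩
  have hm' := mem_primeProducts_of_dvd hm (dvd_mul_left m' a)
  have ha0 := ne_zero_of_mem_primeProducts (mem_primeProducts_of_dvd hm (dvd_mul_right a m'))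
  let J : Ideal A := Submodule.comap (LinearMap.mulLeft A a) L
  have haJ : Ideal.span {a} * J = L := by
    refine le_antisymm (Ideal.span_singleton_mul_le_iff.2 fun z hz => hz) fun l hl => ?_
    obtain ⟨t, rfl⟩ := Ideal.mem_span_singleton.1 (haL hl)
    exact Ideal.mul_mem_mul (Ideal.mem_span_singleton_self a) hl
  have hJ : ∀ p, Prime p → ¬J ≤ Ideal.span {p} := by
    intro p hp hJp
    obtain ⟨m'', rfl⟩ := Ideal.mem_span_singleton.1 (hJp hmL)
    refine hmin m'' ⟨a * p, by ring, ?_⟩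
      ⟨right_ne_zero_of_mul (ne_zero_of_mem_primeProducts hm'), p, hp.not_isUnit, mul_comm p m''⟩
    rw [← haJ, ← Ideal.span_singleton_mul_span_singleton]
    exact Ideal.mul_mono_right hJp
  refine ⟨a, J, ha0, ⟨⟨⟨⟨a, rfl⟩⟩, haL⟩, ?_⟩, haJ, m', hm', hmL⟩
  rintro P ⟨⟨⟨γ, rfl⟩⟩, hγ⟩
  have hγ' : ∀ l ∈ L, γ ∣ l := fun l hl => Ideal.mem_span_singleton.1 (hγ hl)
  exact Ideal.span_singleton_le_span_singleton.2 (dvd_of_forall_dvd_mul hJ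
    (mem_primeProducts_of_dvd hm (hγ' _ hmL)) fun j hj => hγ' _ hj)

theorem not_le_span_prime_of_isLeast {L J : Ideal A} {a : A} (ha : a ≠ 0)
    (hleast : IsLeast {P : Ideal A | P.IsPrincipal ∧ L ≤ P} (Ideal.span {a}))
    (haJ : Ideal.span {a} * J = L) {p : A} (hp : ¬IsUnit p) : ¬J ≤ Ideal.span {p} := by
  intro hJp
  have hL : L ≤ Ideal.span {a * p} := by
    rw [← haJ, ← Ideal.span_singleton_mul_span_singleton]
    exact Ideal.mul_mono_right hJp
  have hdvd : a * p ∣ a * 1 :=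
    (mul_one a).symm ▸ Ideal.span_singleton_le_span_singleton.1 (hleast.2 ⟨⟨⟨_, rfl⟩⟩, hL⟩)
  exact hp (isUnit_of_dvd_one ((mul_dvd_mul_iff_left ha).1 hdvd))

theorem dvd_of_dvd_mul_pow_of_not_dvd {x q a : A} (hx : Prime x) (hq : ¬x ∣ q) {m : ℕ}
    (h : q ∣ a * x ^ m) : q ∣ a := by
  obtain ⟨c, hc⟩ := h
  obtain ⟨d, rfl⟩ := hx.pow_dvd_of_dvd_mul_left m hq (hc ▸ dvd_mul_left _ a)
  exact ⟨d, mul_right_cancel₀ (pow_ne_zero m hx.ne_zero) (by rw [hc]; ring)⟩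

end PrimeProducts

section StrictTransform

theorem isUnit_or_prime_of_map_eq_pow_mul {A B : Type*} [CommRing A] [CommRing B] [IsDomain B]
    {ι : A →+* B} (hι : Function.Injective ι) {x p : A} (hx : Prime (ι x))
    (hfrac : ∀ b, ∃ (a t : A) (n : ℕ), ι a = b * ι t ∧ Associated (ι t) (ι x ^ n))
    (hp : Prime p) {n : ℕ} {q : B} (hpq : ι p = ι x ^ n * q) (hxq : ¬ι x ∣ q) :
    IsUnit q ∨ Prime q := by
  have q_dvd : ∀ {b a t m}, ι a = b * ι t → Associated (ι t) (ι x ^ m) → p ∣ a → q ∣ b := by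
    intro b a t m hab ht hpa
    have hqa : q ∣ b * ι t := hab ▸ (Dvd.intro_left _ hpq.symm).trans (map_dvd ι hpa)
    exact dvd_of_dvd_mul_pow_of_not_dvd hx hxq (hqa.trans (ht.mul_left b).dvd)
  refine or_iff_not_imp_left.2 fun hu => ⟨fun h0 => hxq (h0 ▸ dvd_zero _), hu, ?_⟩
  have not_dvd : ∀ {t m}, Associated (ι t) (ι x ^ m) → ¬p ∣ t := fun ht hpt =>
    hu (isUnit_of_dvd_one (q_dvd (one_mul _).symm ht hpt))
  rintro b c ⟨d, hbc⟩
  obtain ⟨a₁, t₁, n₁, h₁, ht₁⟩ := hfrac b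
  obtain ⟨a₂, t₂, n₂, h₂, ht₂⟩ := hfrac c
  obtain ⟨a₃, t₃, n₃, h₃, ht₃⟩ := hfrac d
  have hdvd : p ∣ a₁ * a₂ * (t₃ * x ^ n) := by
    refine ⟨a₃ * t₁ * t₂, hι ?_⟩
    simp only [map_mul, map_pow, h₁, h₂, h₃, hpq]
    linear_combination (ι t₁ * ι t₂ * ι t₃ * ι x ^ n) * hbc
  have hpt : ¬p ∣ t₃ * x ^ n := fun h => (hp.dvd_or_dvd h).elim (not_dvd ht₃)
    (not_dvd (m := n) (by rw [map_pow]))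
  exact (hp.dvd_or_dvd ((hp.dvd_or_dvd hdvd).resolve_right hpt)).imp (q_dvd h₁ ht₁) (q_dvd h₂ ht₂)

variable {K : Type*} [Field K] {T T' : LocalSubring K} {x : T.toSubring}

theorem IsQuadraticCenter.inclusion_mem_primeProducts (h : IsQuadraticCenter T x T')
    {m : T.toSubring} (hm : m ∈ primeProducts T.toSubring) :
    Subring.inclusion h.transform.2.1 m ∈ primeProducts T'.toSubring := by
  have := h.regular
  set ι := Subring.inclusion h.transform.2.1
  have hι : Function.Injective ι := Subring.inclusion_injective _
  refine (Submonoid.closure_le.2 fun p hp => ?_ :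
    primeProducts T.toSubring ≤ (primeProducts T'.toSubring).comap ι) hm
  rcases hp with hp | hp
  · exact mem_primeProducts_of_isUnit_or_prime (Or.inl (hp.map ι))
  · obtain ⟨n, q, hxq, hpq⟩ := WfDvdMonoid.max_power_factor
      ((map_ne_zero_iff ι hι).2 hp.ne_zero) h.prime.irreducible
    change ι p ∈ primeProducts T'.toSubring
    rw [hpq]
    exact mul_mem (pow_mem (mem_primeProducts_of_isUnit_or_prime (Or.inr h.prime)) n)
      (mem_primeProducts_of_isUnit_or_prime (isUnit_or_prime_of_map_eq_pow_mul hι h.prime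
        h.exists_associated hp hpq hxq))

end StrictTransform

section Blowup

variable {R K : Type*} [CommRing R] [Field K] [Algebra R K] {I : Ideal R}

theorem mem_reesIn_iff {f : K[X]} :
    f ∈ reesIn K I ↔ ∃ g : R[X], (∀ i, g.coeff i ∈ I ^ i) ∧ g.map (algebraMap R K) = f :=
  Iff.rfl

theorem monomial_mem_normRees {n : ℕ} {r : R} (hr : r ∈ I ^ n) :
    monomial n (algebraMap R K r) ∈ normRees K I :=
  mem_normRees.2 <| isIntegral_algebraMap (R := reesIn K I)
    (x := ⟨_, mem_reesIn_iff.2 ⟨monomial n r, reesAlgebra.monomial_mem.2 hr, map_monomial _⟩⟩)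

theorem mk_monomial_mem_normReesPiece {n : ℕ} {c : K} (hc : monomial n c ∈ normRees K I) :
    (⟨_, hc⟩ : normRees K I) ∈ normReesPiece K I n :=
  mem_normReesPiece.2 ⟨c, rfl⟩

-- Comparing coefficients of degree `n * d` in a monic equation of degree `d` satisfied by `c tⁿ`.
theorem exists_pow_add_sum_eq_zero {n : ℕ} {c : K} (hc : monomial n c ∈ normRees K I) :
    ∃ (d : ℕ) (r : ℕ → R), (∀ i, r i ∈ I ^ (n * (d - i))) ∧
      c ^ d + ∑ i ∈ Finset.range d, algebraMap R K (r i) * c ^ i = 0 := by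
  obtain ⟨q, hq, hq0⟩ := mem_normRees.1 hc
  have hcoeff : ∀ i, ∃ r ∈ I ^ (n * (q.natDegree - i)),
      algebraMap R K r = (q.coeff i : K[X]).coeff (n * (q.natDegree - i)) := fun i => by
    obtain ⟨g, hg, hg'⟩ := mem_reesIn_iff.1 (q.coeff i).2
    exact ⟨_, hg _, by rw [← hg', coeff_map]⟩
  choose r hr hr' using hcoeff
  refine ⟨q.natDegree, r, hr, ?_⟩
  rw [eval₂_eq_sum_range, Finset.sum_range_succ, hq.coeff_natDegree, map_one, one_mul,
    add_comm] at hq0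
  replace hq0 := congrArg (coeff · (n * q.natDegree)) hq0
  simp only [coeff_add, finsetSum_coeff, coeff_zero, monomial_pow, coeff_monomial_same] at hq0
  rw [← hq0]
  congr 1
  refine Finset.sum_congr rfl fun i hi => ?_
  have hdeg : n * q.natDegree = n * (q.natDegree - i) + n * i := by
    rw [← mul_add, Nat.sub_add_cancel (Finset.mem_range.1 hi).le]
  rw [hr', hdeg, coeff_mul_monomial]
  rfl

theorem isIntegral_of_pow_add_sum_eq_zero {A B : Type*} [CommRing A] [CommRing B] [Algebra A B]
    {b : B} {d : ℕ} (a : ℕ → A)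
    (h : b ^ d + ∑ i ∈ Finset.range d, algebraMap A B (a i) * b ^ i = 0) : IsIntegral A b := by
  refine ⟨X ^ d + ∑ i : Fin d, C (a i) * X ^ (i : ℕ),
    monic_X_pow_add (degree_sum_fin_lt fun i : Fin d => a i), ?_⟩
  rw [Finset.sum_range] at h
  simpa [eval₂_finsetSum] using h

theorem div_pow_mem_of_monomial_mem_normRees {A : Subring K} (hRA : ∀ r, algebraMap R K r ∈ A)
    (hA : ∀ k : K, IsIntegral A k → k ∈ A) {z : K} (hz : ∀ i ∈ I, algebraMap R K i / z ∈ A)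
    {n : ℕ} {c : K} (hc : monomial n c ∈ normRees K I) : c / z ^ n ∈ A := by
  obtain ⟨d, r, hr, hc⟩ := exists_pow_add_sum_eq_zero hc
  refine hA _ (isIntegral_of_pow_add_sum_eq_zero (d := d)
    (fun i => ⟨_, algebraMap_div_pow_mem hRA hz (hr i)⟩) ?_)
  have hterm : ∀ i ∈ Finset.range d,
      algebraMap R K (r i) / z ^ (n * (d - i)) * (c / z ^ n) ^ i =
        algebraMap R K (r i) * c ^ i / z ^ (n * d) := fun i hi => by
    rw [div_pow, ← pow_mul, div_mul_div_comm, ← pow_add, ← mul_add,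
      Nat.sub_add_cancel (Finset.mem_range.1 hi).le]
  refine (congrArg _ (Finset.sum_congr rfl hterm)).trans ?_
  rw [← Finset.sum_div, div_pow, ← pow_mul, ← add_div, hc, zero_div]

/-- The elements `r` of `R` with `r tⁿ` in the ideal `p` of the integral closure of `R[It]`. -/
def coeffIdeal (p : Ideal (normRees K I)) (n : ℕ) : Ideal R where
  carrier := {r | ∃ f ∈ p, (f : K[X]) = monomial n (algebraMap R K r)}
  zero_mem' := ⟨0, p.zero_mem, by simp⟩
  add_mem' := by
    rintro _ _ ⟨f, hf, hf'⟩ ⟨g, hg, hg'⟩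
    exact ⟨f + g, p.add_mem hf hg, by simp [hf', hg']⟩
  smul_mem' := by
    rintro r _ ⟨f, hf, hf'⟩
    exact ⟨r • f, p.smul_of_tower_mem r hf, by simp [hf', Algebra.smul_def]⟩

theorem pow_le_coeffIdeal {p : Ideal (normRees K I)} (h : I ≤ coeffIdeal p 1) {n : ℕ}
    (hn : n ≠ 0) : I ^ n ≤ coeffIdeal p n := by
  obtain ⟨m, rfl⟩ := Nat.exists_eq_succ_of_ne_zero hn
  rw [Nat.succ_eq_add_one, pow_succ, Ideal.mul_le]
  intro r hr s hs
  obtain ⟨f, hf, hfs⟩ := h hs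
  refine ⟨⟨_, monomial_mem_normRees hr⟩ * f, p.mul_mem_left _ hf, ?_⟩
  rw [MulMemClass.coe_mul, hfs, monomial_mul_monomial, (algebraMap R K).map_mul]

theorem exists_pow_mem_of_le_coeffIdeal {p : Ideal (normRees K I)} (h : I ≤ coeffIdeal p 1)
    {n : ℕ} (hn : n ≠ 0) {f : normRees K I} (hf : f ∈ normReesPiece K I n) : ∃ d, f ^ d ∈ p := by
  obtain ⟨c, hc⟩ := mem_normReesPiece.1 hf
  obtain ⟨d, r, hr, hcd⟩ := exists_pow_add_sum_eq_zero (hc ▸ f.2)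
  have hcoeff : ∀ i < d, ∃ g ∈ p, (g : K[X]) = monomial (n * (d - i)) (algebraMap R K (r i)) :=
    fun i hi => pow_le_coeffIdeal h (Nat.mul_ne_zero hn (Nat.sub_ne_zero_of_lt hi)) (hr i)
  choose! g hg hg' using hcoeff
  have hterm : ∀ i ∈ Finset.range d, ((g i * f ^ i : normRees K I) : K[X]) =
      monomial (n * d) (algebraMap R K (r i) * c ^ i) := fun i hi => by
    have hid := Finset.mem_range.1 hi
    rw [MulMemClass.coe_mul, SubmonoidClass.coe_pow, hg' i hid, ← hc, monomial_pow,
      monomial_mul_monomial, ← mul_add, Nat.sub_add_cancel hid.le]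
  have hfd : f ^ d + ∑ i ∈ Finset.range d, g i * f ^ i = 0 := by
    refine Subtype.ext ?_
    rw [AddMemClass.coe_add, AddSubmonoidClass.coe_finsetSum, Finset.sum_congr rfl hterm,
      SubmonoidClass.coe_pow, ← hc, monomial_pow, ← map_sum, ← map_add, hcd, map_zero]
    rfl
  refine ⟨d, eq_neg_of_add_eq_zero_left hfd ▸ p.neg_mem (p.sum_mem fun i hi => ?_)⟩
  exact p.mul_mem_right _ (hg i (Finset.mem_range.1 hi))

theorem exists_mem_notMem_coeffIdeal (p : ProjectiveSpectrum (normReesPiece K I)) :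
    ∃ a ∈ I, a ∉ coeffIdeal p.asHomogeneousIdeal.toIdeal 1 := by
  by_contra! h
  refine p.not_irrelevant_le ((HomogeneousIdeal.irrelevant_le _).2 fun n hn f hf => ?_)
  obtain ⟨d, hd⟩ := exists_pow_mem_of_le_coeffIdeal h hn.ne' hf
  exact p.isPrime.mem_of_pow_mem d hd

theorem IsOnNormalizedBlowup.exists_generator {S : LocalSubring K}
    (hS : IsOnNormalizedBlowup I S) :
    ∃ a ∈ I, algebraMap R K a ≠ 0 ∧ (∀ i ∈ I, algebraMap R K i / algebraMap R K a ∈ S.toSubring) ∧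
      ∀ s ∈ S.toSubring, ∃ (n : ℕ) (c e : K), monomial n c ∈ normRees K I ∧
        monomial n e ∈ normRees K I ∧ e ≠ 0 ∧ s = c / e ∧
        algebraMap R K a ^ n / e ∈ S.toSubring := by
  obtain ⟨p, hp⟩ := hS
  have hmem : ∀ {k : K}, k ∈ S.toSubring ↔ ∃ n : ℕ, ∃ a ∈ normReesPiece K I n,
      ∃ b ∈ normReesPiece K I n, b ∉ p.asHomogeneousIdeal ∧
        k = (a : K[X]).coeff n / (b : K[X]).coeff n := fun {k} => Set.ext_iff.1 hp k
  obtain ⟨a, ha, hap⟩ := exists_mem_notMem_coeffIdeal p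
  have ha' : a ∈ I ^ 1 := (pow_one I).symm ▸ ha
  let at₁ : normRees K I := ⟨_, monomial_mem_normRees (K := K) ha'⟩
  have hat₁ : at₁ ∉ p.asHomogeneousIdeal := fun h => hap ⟨at₁, h, rfl⟩
  refine ⟨a, ha, fun h0 => hap ⟨0, Ideal.zero_mem _, by simp [h0]⟩, fun i hi => ?_, fun s hs => ?_⟩
  · exact hmem.2 ⟨1, _, mk_monomial_mem_normReesPiece (monomial_mem_normRees (by rwa [pow_one])),
      at₁, mk_monomial_mem_normReesPiece _, hat₁, by simp [at₁]⟩
  · obtain ⟨n, f, hf, g, hg, hgp, rfl⟩ := hmem.1 hs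
    obtain ⟨c, hc⟩ := mem_normReesPiece.1 hf
    obtain ⟨e, he⟩ := mem_normReesPiece.1 hg
    have hatn : at₁ ^ n ∈ normReesPiece K I n :=
      mem_normReesPiece.2 ⟨algebraMap R K a ^ n, by simp [at₁, monomial_pow]⟩
    refine ⟨n, c, e, hc ▸ f.2, he ▸ g.2, fun h0 => hgp ?_, by simp [← hc, ← he],
      hmem.2 ⟨n, _, hatn, g, hg, hgp, by simp [← he, at₁, monomial_pow]⟩⟩
    have hg0 : g = 0 := Subtype.ext (by simp [← he, h0])
    exact hg0 ▸ Ideal.zero_mem _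

theorem exists_eq_mul_of_extension_eq_span {T : Subring K} (hRT : ∀ r, algebraMap R K r ∈ T)
    {z : T} (hz : extension I T = Ideal.span {z}) {i : R} (hi : i ∈ I) :
    ∃ t ∈ T, algebraMap R K i = z * t := by
  have him : (⟨_, hRT i⟩ : T) ∈ extension I T := Ideal.subset_span ⟨i, hi, rfl⟩
  rw [hz] at him
  obtain ⟨t, ht⟩ := Ideal.mem_span_singleton.1 him
  exact ⟨t, t.2, congrArg Subtype.val ht⟩

-- For `s = c / e` in `S`, both `c / zⁿ` and `e / zⁿ` lie in `T`, and `e / zⁿ` is a unit of `V`,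
-- hence of `T`.
theorem IsOnNormalizedBlowup.le_of_extension_eq {S T V : LocalSubring K}
    (hS : IsOnNormalizedBlowup I S) (hSV : S ≤ V) (hTV : T ≤ V)
    (hRT : ∀ r, algebraMap R K r ∈ T.toSubring) (hT : ∀ k : K, IsIntegral T.toSubring k →
      k ∈ T.toSubring) {z : T.toSubring} (hz : extension I T.toSubring = Ideal.span {z}) :
    S ≤ T := by
  obtain ⟨a, ha, ha0, haS, hfrac⟩ := hS.exists_generator
  have hz0 : (z : K) ≠ 0 := fun h0 => by
    obtain ⟨t, -, ht⟩ := exists_eq_mul_of_extension_eq_span hRT hz ha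
    exact ha0 (by rw [ht, h0, zero_mul])
  have hIz : ∀ i ∈ I, algebraMap R K i / z ∈ T.toSubring := fun i hi => by
    obtain ⟨t, ht, hit⟩ := exists_eq_mul_of_extension_eq_span hRT hz hi
    rwa [hit, mul_div_cancel_left₀ _ hz0]
  have hza : (z : K) / algebraMap R K a ∈ V.toSubring := by
    refine div_mem_of_mem_span hTV.1 ?_ (hz ▸ Ideal.mem_span_singleton_self z :
      z ∈ extension I T.toSubring)
    rintro w ⟨i, hi, hw⟩
    exact hw ▸ hSV.1 (haS i hi)
  refine le_of_toSubring_le hSV hTV fun s hs => ?_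
  obtain ⟨n, c, e, hc, he, he0, rfl, haeS⟩ := hfrac s hs
  have hcT := div_pow_mem_of_monomial_mem_normRees hRT hT hIz hc
  have heT := div_pow_mem_of_monomial_mem_normRees hRT hT hIz he
  have hunit : (e / (z : K) ^ n)⁻¹ ∈ V.toSubring := by
    have heq : (e / (z : K) ^ n)⁻¹ =
        algebraMap R K a ^ n / e * (z / algebraMap R K a : K) ^ n := by
      rw [div_pow]
      field_simp
    exact heq ▸ mul_mem (hSV.1 haeS) (pow_mem hza n)
  have hdiv := mul_mem hcT (inv_mem_of_mem_of_le hTV heT hunit)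
  rwa [← div_eq_mul_inv, div_div_div_cancel_right₀ (pow_ne_zero n hz0)] at hdiv

end Blowup

section Extension

variable {R K : Type*} [CommRing R] [Field K] [Algebra R K] {I : Ideal R}

theorem map_extension {A B : Subring K} (h : A ≤ B) (hRA : ∀ r, algebraMap R K r ∈ A) :
    (extension I A).map (Subring.inclusion h) = extension I B := by
  rw [extension, Ideal.map_span]
  congr 1
  ext b
  constructor
  · rintro ⟨a, ⟨r, hr, har⟩, rfl⟩
    exact ⟨r, hr, har⟩
  · rintro ⟨r, hr, hbr⟩
    exact ⟨⟨_, hRA r⟩, ⟨r, hr, rfl⟩, Subtype.ext hbr.symm⟩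

theorem extension_eq_span_of_le {A B : Subring K} (h : A ≤ B) (hRA : ∀ r, algebraMap R K r ∈ A)
    {z : A} (hz : extension I A = Ideal.span {z}) :
    extension I B = Ideal.span {Subring.inclusion h z} := by
  rw [← map_extension h hRA, hz, Ideal.map_span, Set.image_singleton]

-- A generator of `L.map` may be taken of the form `a * g` with `g ∈ J`. Then `g` divides every
-- element of `J` up to a factor outside `𝔭`, so `g` has a prime factor in `𝔭`, which divides `J`.
theorem not_isPrincipal_map_of_isLeast {A B : Type*} [CommRing A] [IsDomain A] [CommRing B]
    [Algebra A B] {𝔭 : Ideal A} [𝔭.IsPrime] [IsLocalization.AtPrime B 𝔭] {L J : Ideal A} {a : A}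
    (ha : a ≠ 0) (hleast : IsLeast {P : Ideal A | P.IsPrincipal ∧ L ≤ P} (Ideal.span {a}))
    (haJ : Ideal.span {a} * J = L) (hJ : J ≤ 𝔭) {m : A} (hm : m ∈ primeProducts A)
    (hmJ : m ∈ J) : ¬(L.map (algebraMap A B)).IsPrincipal := by
  rintro ⟨γ, hγ⟩
  have hγL : γ ∈ L.map (algebraMap A B) := hγ ▸ Submodule.mem_span_singleton_self γ
  obtain ⟨⟨⟨t, ht⟩, u⟩, htu⟩ := (IsLocalization.mem_map_algebraMap_iff 𝔭.primeCompl B).1 hγL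
  obtain ⟨g, hg, rfl⟩ := Ideal.mem_span_singleton_mul.1 (haJ.symm ▸ ht)
  have hspan : L.map (algebraMap A B) = (Ideal.span {a * g}).map (algebraMap A B) := by
    rw [Ideal.map_span, Set.image_singleton, ← htu,
      Ideal.span_singleton_mul_right_unit (IsLocalization.map_units B u), hγ]
  have key : ∀ j ∈ J, ∃ v ∉ 𝔭, g ∣ v * j := by
    intro j hj
    have hjL : algebraMap A B (a * j) ∈ (Ideal.span {a * g}).map (algebraMap A B) :=
      hspan ▸ Ideal.mem_map_of_mem _ (haJ ▸ Ideal.mul_mem_mul (Ideal.mem_span_singleton_self a) hj)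
    obtain ⟨v, hv, hvj⟩ :=
      (IsLocalization.algebraMap_mem_map_algebraMap_iff 𝔭.primeCompl B _ _).1 hjL
    rw [Ideal.mem_span_singleton, mul_left_comm, mul_dvd_mul_iff_left ha] at hvj
    exact ⟨v, hv, hvj⟩
  obtain ⟨v, hv, hvm⟩ := key m hmJ
  obtain ⟨p, hp𝔭, hp, hpg⟩ := exists_prime_dvd_of_dvd_mul hm hv (hJ hg) hvm
  refine not_le_span_prime_of_isLeast ha hleast haJ hp.not_isUnit fun j hj => ?_
  obtain ⟨v, hv, hvj⟩ := key j hj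
  exact Ideal.mem_span_singleton.2 ((hp.dvd_or_dvd (hpg.trans hvj)).resolve_left fun hpv =>
    hv (Ideal.mem_of_dvd _ hpv hp𝔭))

theorem extension_ofPrime_ne_span {T : Subring K} (hRT : ∀ r, algebraMap R K r ∈ T)
    {𝔭 : Ideal T} [𝔭.IsPrime] {a : T} {J : Ideal T} (ha : a ≠ 0)
    (hleast : IsLeast {P : Ideal T | P.IsPrincipal ∧ extension I T ≤ P} (Ideal.span {a}))
    (haJ : Ideal.span {a} * J = extension I T) (hJ : J ≤ 𝔭) {m : T} (hm : m ∈ primeProducts T)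
    (hmJ : m ∈ J) (γ : (LocalSubring.ofPrime T 𝔭).toSubring) :
    extension I (LocalSubring.ofPrime T 𝔭).toSubring ≠ Ideal.span {γ} := by
  intro hγ
  refine not_isPrincipal_map_of_isLeast (B := (LocalSubring.ofPrime T 𝔭).toSubring)
    ha hleast haJ hJ hm hmJ ⟨γ, ?_⟩
  exact (map_extension (LocalSubring.le_ofPrime T 𝔭) hRT).trans hγ

end Extension

theorem isPrincipalIdealRing_of_ringKrullDim_lt_two {A : Type*} [CommRing A] [IsDomain A]
    [IsRegularLocalRing A] (h : ringKrullDim A < 2) : IsPrincipalIdealRing A := by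
  refine ((tfae_of_isNoetherianRing_of_isLocalRing_of_isDomain A).out 3 0).1 ?_
  refine ⟨inferInstance, fun P hP0 hP => ?_⟩
  by_contra hPm
  refine h.not_ge ?_
  rw [← maximalIdeal_height_eq_ringKrullDim]
  exact WithBot.coe_le_coe.2 (two_le_height_of_bot_lt_of_lt (bot_lt_iff_ne_bot.2 hP0)
    (lt_of_le_of_ne (le_maximalIdeal hP.ne_top) hPm))

section GoodPoints

variable {R K : Type*} [CommRing R] [IsLocalRing R] [Field K] [Algebra R K] {I : Ideal R}

/-- A regular local ring obtained from `R` by finitely many local quadratic transforms, not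
necessarily of dimension at least two, such that, except at the start, `I` extends to an ideal
containing a product of prime elements. -/
structure IsGoodPoint (I : Ideal R) (T : LocalSubring K) : Prop where
  regular : IsRegularLocalRing T.toSubring
  le : LocalSubring.range (algebraMap R K) ≤ T
  chain : Relation.ReflTransGen IsLocalQuadraticTransform (LocalSubring.range (algebraMap R K)) T
  primes : T = LocalSubring.range (algebraMap R K) ∨
    ∃ m ∈ primeProducts T.toSubring, m ∈ extension I T.toSubring

theorem algebraMap_mem_of_le {T : LocalSubring K} (h : LocalSubring.range (algebraMap R K) ≤ T)
    (r : R) : algebraMap R K r ∈ T.toSubring := h.1 ⟨r, rfl⟩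

theorem IsGoodPoint.exists_extension_eq_span {T : LocalSubring K} (hT : IsGoodPoint I T)
    (hm : ∃ m ∈ primeProducts T.toSubring, m ∈ extension I T.toSubring)
    (hbase : ¬IsBasePoint I T) : ∃ z, extension I T.toSubring = Ideal.span {z} := by
  have := hT.regular
  rcases lt_or_ge (ringKrullDim T.toSubring) 2 with hdim | hdim
  · have := isPrincipalIdealRing_of_ringKrullDim_lt_two hdim
    exact (IsPrincipalIdealRing.principal (extension I T.toSubring)).principal
  · obtain ⟨m, hm, hmI⟩ := hm
    obtain ⟨a, J, ha, hleast, haJ, -⟩ := exists_isLeast_principal hm hmI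
    have hJ : J = ⊤ := by
      by_contra hJ
      exact hbase ⟨⟨hT.regular, hdim, hT.le, hT.chain⟩, J, ⟨a, ha, hleast, haJ⟩, hJ⟩
    exact ⟨a, by rw [← haJ, hJ, Ideal.mul_top]⟩

theorem isLeast_principal_of_maximalIdeal_le_radical {A : Type*} [CommRing A] [IsLocalRing A]
    [IsNoetherianRing A] (hdim : 2 ≤ ringKrullDim A) {L : Ideal A}
    (hL : maximalIdeal A ≤ L.radical) :
    IsLeast {P : Ideal A | P.IsPrincipal ∧ L ≤ P} (Ideal.span {1}) := by
  refine ⟨⟨⟨⟨1, rfl⟩⟩, by simp⟩, fun P ⟨hP, hLP⟩ => ?_⟩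
  rw [eq_top_of_isPrincipal_of_maximalIdeal_le_radical hdim hP (hL.trans (Ideal.radical_mono hLP))]
  exact le_top

variable [IsFractionRing R K]

theorem isFractionRing_of_le {T : LocalSubring K} (h : LocalSubring.range (algebraMap R K) ≤ T) :
    IsFractionRing T.toSubring K := by
  refine IsFractionRing.of_field T.toSubring K fun z => ?_
  obtain ⟨a, b, -, rfl⟩ := IsFractionRing.div_surjective (A := R) z
  exact ⟨⟨_, algebraMap_mem_of_le h a⟩, ⟨_, algebraMap_mem_of_le h b⟩, rfl⟩

theorem mem_of_isIntegral_of_le {T : LocalSubring K} [IsRegularLocalRing T.toSubring]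
    (h : LocalSubring.range (algebraMap R K) ≤ T) {k : K} (hk : IsIntegral T.toSubring k) :
    k ∈ T.toSubring := by
  have := isFractionRing_of_le h
  obtain ⟨y, rfl⟩ := IsIntegrallyClosed.isIntegral_iff.1 hk
  exact y.2

variable (R K) in
/-- `R` identified with its image in its field of fractions `K`. -/
def rangeEquiv : R ≃+* (LocalSubring.range (algebraMap R K)).toSubring :=
  RingEquiv.ofBijective (algebraMap R K).rangeRestrict
    ⟨fun _ _ hab => IsFractionRing.injective R K (congrArg Subtype.val hab),
      (algebraMap R K).rangeRestrict_surjective⟩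

theorem extension_range :
    extension I (LocalSubring.range (algebraMap R K)).toSubring = I.map (rangeEquiv R K) := by
  rw [extension, Ideal.map]
  congr 1
  ext s
  exact exists_congr fun r => and_congr_right fun _ =>
    eq_comm.trans (Subtype.ext_iff (a1 := rangeEquiv R K r) (a2 := s)).symm

theorem radical_extension_range (hI : I.radical = maximalIdeal R) :
    (extension I (LocalSubring.range (algebraMap R K)).toSubring).radical = maximalIdeal _ := by
  have hmap := Ideal.map_radical_of_surjective (f := (rangeEquiv R K).toRingHom) (I := I)
    (rangeEquiv R K).surjective ((RingHom.ker_coe_equiv (rangeEquiv R K)).trans_le bot_le)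
  rw [hI] at hmap
  exact (congrArg Ideal.radical extension_range).trans
    (hmap.symm.trans (map_ringEquiv_maximalIdeal (rangeEquiv R K)))

theorem IsGoodPoint.exists_mem_primeProducts (hI : I.radical = maximalIdeal R)
    {T T' : LocalSubring K} (hT : IsGoodPoint I T) {x : T.toSubring}
    (h : IsQuadraticCenter T x T') :
    ∃ m ∈ primeProducts T'.toSubring, m ∈ extension I T'.toSubring := by
  have hmap : ∀ {y : T.toSubring}, y ∈ extension I T.toSubring →
      Subring.inclusion h.transform.2.1 y ∈ extension I T'.toSubring := fun hy => by
    rw [← map_extension h.transform.2.1 (algebraMap_mem_of_le hT.le)]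
    exact Ideal.mem_map_of_mem _ hy
  rcases hT.primes with rfl | ⟨m, hm, hmI⟩
  · obtain ⟨N, hN⟩ := (radical_extension_range hI).ge h.mem
    refine ⟨_, pow_mem (mem_primeProducts_of_isUnit_or_prime (Or.inr h.prime)) N, ?_⟩
    exact map_pow (Subring.inclusion h.transform.2.1) x N ▸ hmap hN
  · exact ⟨_, h.inclusion_mem_primeProducts hm, hmap hmI⟩

theorem IsGoodPoint.of_isQuadraticCenter (hI : I.radical = maximalIdeal R)
    {T T' : LocalSubring K} (hT : IsGoodPoint I T) {x : T.toSubring}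
    (h : IsQuadraticCenter T x T') : IsGoodPoint I T' where
  regular := h.regular
  le := hT.le.trans h.transform.2
  chain := hT.chain.tail h.transform
  primes := Or.inr (hT.exists_mem_primeProducts hI h)

end GoodPoints

section Range

variable {R K : Type*} [CommRing R] [IsRegularLocalRing R] [Field K] [Algebra R K]
  [IsFractionRing R K] {I : Ideal R}

theorem isGoodPoint_range : IsGoodPoint I (LocalSubring.range (algebraMap R K)) where
  regular := .of_ringEquiv (rangeEquiv R K)
  le := le_rfl
  chain := .refl
  primes := Or.inl rfl

theorem isTransform_extension_range
    (hdim : 2 ≤ ringKrullDim (LocalSubring.range (algebraMap R K)).toSubring)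
    (hI : I.radical = maximalIdeal R) :
    IsTransform I (LocalSubring.range (algebraMap R K)).toSubring (extension I _) := by
  have := (isGoodPoint_range (I := I) (K := K)).regular
  exact ⟨1, one_ne_zero, isLeast_principal_of_maximalIdeal_le_radical hdim
    (radical_extension_range hI).ge, by simp⟩

theorem isBasePoint_range (hdim : 2 ≤ ringKrullDim R) (hI : I.radical = maximalIdeal R) :
    IsBasePoint I (LocalSubring.range (algebraMap R K)) := by
  rw [ringKrullDim_eq_of_ringEquiv (rangeEquiv R K)] at hdim
  refine ⟨⟨(isGoodPoint_range (I := I)).regular, hdim, le_rfl, .refl⟩, extension I _,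
    isTransform_extension_range hdim hI, ne_top_of_le_ne_top (maximalIdeal.isMaximal _).ne_top
      (Ideal.le_radical.trans (radical_extension_range hI).le)⟩

end Range

theorem exists_forall_div_mem_valuationSubring {F ι : Type*} [Field F] (W : ValuationSubring F)
    {s : Finset ι} {f : ι → F} (h : ∃ i ∈ s, f i ≠ 0) :
    ∃ i ∈ s, f i ≠ 0 ∧ ∀ j ∈ s, f j / f i ∈ W := by
  obtain ⟨i₀, hi₀, h0⟩ := h
  obtain ⟨i, hi, hmax⟩ := s.exists_max_image (fun i => W.valuation (f i)) ⟨i₀, hi₀⟩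
  refine ⟨i, hi, fun hi0 => h0 ?_, fun j hj => ?_⟩
  · simpa only [hi0, map_zero, le_zero_iff, map_eq_zero] using hmax i₀ hi₀
  · rw [← W.valuation_le_one_iff, map_div₀]
    exact div_le_one_of_le₀ (hmax j hj) zero_le

theorem maximalIdealBecomesPrincipal_valuationSubring {K : Type*} [Field K] {T : LocalSubring K}
    (hT : (maximalIdeal T.toSubring).FG) (hT0 : maximalIdeal T.toSubring ≠ ⊥)
    {V : ValuationSubring K} (hTV : T.toSubring ≤ V.toSubring) :
    MaximalIdealBecomesPrincipal T V.toLocalSubring := by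
  obtain ⟨g, hg⟩ := hT
  have hg0 : ∃ y ∈ g, (y : K) ≠ 0 := by
    by_contra! h
    exact hT0 (hg ▸ Ideal.span_eq_bot.2 fun y hy => Subtype.ext (h y hy))
  obtain ⟨x, hx, hx0, hdiv⟩ := exists_forall_div_mem_valuationSubring V hg0
  refine ⟨x, hg ▸ Ideal.subset_span hx, fun h => hx0 (congrArg Subtype.val h), fun y hy => ?_⟩
  rw [← hg] at hy
  exact div_mem_of_mem_span hTV hdiv hy

section Composite

theorem isLocalRing_comap_residue {A : Type*} [CommRing A] [IsLocalRing A]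
    (W : ValuationSubring (ResidueField A)) : IsLocalRing (W.toSubring.comap (residue A)) := by
  let φ : W.toSubring.comap (residue A) →+* W.toSubring :=
    (residue A).restrict (W.toSubring.comap (residue A)) W.toSubring fun _ h => h
  have hφ : IsLocalHom φ := by
    refine ⟨fun d hd => ?_⟩
    obtain ⟨w, hw⟩ := hd.exists_right_inv
    have hw' : residue A d * (w : ResidueField A) = 1 := congrArg Subtype.val hw
    obtain ⟨e, he⟩ := ((residue_ne_zero_iff_isUnit _).1
      (left_ne_zero_of_mul_eq_one hw')).exists_right_inv
    have he' : residue A e = w :=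
      mul_left_cancel₀ (left_ne_zero_of_mul_eq_one hw') (by rw [← map_mul, he, map_one, hw'])
    have heW : residue A e ∈ W := he' ▸ w.2
    exact .of_mul_eq_one ⟨e, heW⟩ (Subtype.ext he)
  have : IsLocalRing W.toSubring := inferInstanceAs (IsLocalRing W)
  exact φ.domain_isLocalRing

variable {K : Type*} [Field K]

/-- The composite of a local subring `O` with a valuation ring `W` of its residue field: the
preimage of `W` in `O`. -/
def composite (O : LocalSubring K) (W : ValuationSubring (ResidueField O.toSubring)) :
    LocalSubring K :=
  have := isLocalRing_comap_residue W
  LocalSubring.map O.toSubring.subtype ⟨W.toSubring.comap (residue O.toSubring)⟩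

variable {O : LocalSubring K} {W : ValuationSubring (ResidueField O.toSubring)}

theorem mem_composite_iff {k : K} :
    k ∈ (composite O W).toSubring ↔ ∃ h : k ∈ O.toSubring, residue O.toSubring ⟨k, h⟩ ∈ W := by
  constructor
  · rintro ⟨k, hk, rfl⟩
    exact ⟨k.2, hk⟩
  · rintro ⟨h, hk⟩
    exact ⟨⟨k, h⟩, hk, rfl⟩

theorem composite_toSubring_le : (composite O W).toSubring ≤ O.toSubring :=
  fun _ hk => (mem_composite_iff.1 hk).1

theorem le_composite {T : LocalSubring K} (hTO : T.toSubring ≤ O.toSubring)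
    (hW : ∀ a, (residue O.toSubring).comp (Subring.inclusion hTO) a ∈ W.toSubring)
    (hloc : IsLocalHom
      (((residue O.toSubring).comp (Subring.inclusion hTO)).codRestrict W.toSubring hW)) :
    T ≤ composite O W := by
  refine le_iff_inv_mem.2 ⟨fun a ha => mem_composite_iff.2 ⟨hTO ha, hW ⟨a, ha⟩⟩, ?_⟩
  intro a ha ha0 hainv
  obtain ⟨h, hr⟩ := mem_composite_iff.1 hainv
  rw [← isUnit_iff_inv_mem ha ha0]
  refine hloc.map_nonunit ⟨a, ha⟩ (.of_mul_eq_one ⟨_, hr⟩ (Subtype.ext ?_))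
  change residue O.toSubring ⟨a, hTO ha⟩ * residue O.toSubring ⟨a⁻¹, h⟩ = 1
  rw [← map_mul, ← map_one (residue O.toSubring)]
  exact congrArg _ (Subtype.ext (mul_inv_cancel₀ ha0))

theorem exists_le_composite {T : LocalSubring K} (hTO : T.toSubring ≤ O.toSubring) :
    ∃ W : ValuationSubring (ResidueField O.toSubring), T ≤ composite O W := by
  obtain ⟨W, hW, hloc⟩ := exists_factor_valuationRing
    ((residue O.toSubring).comp (Subring.inclusion hTO))
  exact ⟨W, le_composite hTO hW hloc⟩

theorem div_mem_composite {x y : O.toSubring} (hx : residue O.toSubring x ≠ 0)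
    (h : residue O.toSubring y / residue O.toSubring x ∈ W) :
    (y / x : K) ∈ (composite O W).toSubring := by
  have hu := (residue_ne_zero_iff_isUnit x).1 hx
  have hx0 : (x : K) ≠ 0 := fun h0 => hu.ne_zero (Subtype.ext h0)
  have hyx : (y / x : K) ∈ O.toSubring :=
    div_eq_mul_inv (y : K) x ▸ mul_mem y.2 ((isUnit_iff_inv_mem x.2 hx0).1 hu)
  refine mem_composite_iff.2 ⟨hyx, ?_⟩
  convert h
  rw [eq_div_iff hx, ← map_mul]
  exact congrArg _ (Subtype.ext (div_mul_cancel₀ _ hx0))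

theorem maximalIdealBecomesPrincipal_composite {T : LocalSubring K}
    (hT : (maximalIdeal T.toSubring).FG) (hTD : T.toSubring ≤ (composite O W).toSubring)
    {t : T.toSubring} (ht : t ∈ maximalIdeal T.toSubring) (ht0 : t ≠ 0)
    (htO : (t : K)⁻¹ ∈ O.toSubring) : MaximalIdealBecomesPrincipal T (composite O W) := by
  classical
  have hTO := hTD.trans composite_toSubring_le
  let ρ := (residue O.toSubring).comp (Subring.inclusion hTO)
  have hρt : ρ t ≠ 0 := (residue_ne_zero_iff_isUnit _).2
    ((isUnit_iff_inv_mem (hTO t.2) fun h => ht0 (Subtype.ext h)).2 htO)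
  obtain ⟨g, hg⟩ := hT
  obtain ⟨x, hx, hx0, hdiv⟩ := exists_forall_div_mem_valuationSubring W (s := insert t g)
    (f := ρ) ⟨t, Finset.mem_insert_self t g, hρt⟩
  refine ⟨x, ?_, fun h => hx0 (h ▸ map_zero ρ), fun y hy => ?_⟩
  · rcases Finset.mem_insert.1 hx with rfl | hxg
    · exact ht
    · exact hg ▸ Ideal.subset_span hxg
  · rw [← hg] at hy
    exact div_mem_of_mem_span hTD
      (fun y hy => div_mem_composite hx0 (hdiv y (Finset.mem_insert_of_mem hy))) hy

end Composite

theorem IsTransform.unique {R K : Type*} [CommRing R] [Field K] [Algebra R K] {I : Ideal R}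
    {S : Subring K} {J J' : Ideal S} (h : IsTransform I S J) (h' : IsTransform I S J') :
    J = J' := by
  obtain ⟨a, ha, hleast, haJ⟩ := h
  obtain ⟨a', -, hleast', haJ'⟩ := h'
  rw [← haJ', ← hleast.unique hleast'] at haJ
  exact (Ideal.span_singleton_mul_right_inj ha).1 haJ

section Primary

variable {R K : Type*} [CommRing R] [IsRegularLocalRing R] [Field K] [Algebra R K]
  [IsFractionRing R K] {I : Ideal R}

-- Among the finitely many base points dominated by `D`, take a maximal one: the center of `D` on
-- its quadratic transforms is no longer a base point.
theorem exists_isQuadraticCenter_extension_eq_span (hI : I.radical = maximalIdeal R)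
    (hfin : IsFinitelySupported K I) {T D : LocalSubring K} (hT : IsGoodPoint I T)
    (hbase : IsBasePoint I T) (hTD : T ≤ D)
    (hD : ∀ T' : LocalSubring K, IsGoodPoint I T' → IsBasePoint I T' → T ≤ T' → T' ≤ D →
      MaximalIdealBecomesPrincipal T' D) :
    ∃ (T₁ T₂ : LocalSubring K) (x : T₁.toSubring), IsBasePoint I T₁ ∧ IsGoodPoint I T₂ ∧
      IsQuadraticCenter T₁ x T₂ ∧ T₂ ≤ D ∧ ∃ z, extension I T₂.toSubring = Ideal.span {z} := by
  obtain ⟨T₁, hT₁⟩ := (hfin.subset (t := {T' : LocalSubring K | IsBasePoint I T' ∧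
    IsGoodPoint I T' ∧ T ≤ T' ∧ T' ≤ D}) fun _ h => h.1).exists_maximal
    ⟨T, hbase, hT, le_rfl, hTD⟩
  obtain ⟨hb₁, hg₁, hTT₁, hT₁D⟩ := hT₁.prop
  have := hg₁.regular
  obtain ⟨x, T₂, hc, hT₂D⟩ := exists_isQuadraticCenter hT₁D (hD T₁ hg₁ hb₁ hTT₁ hT₁D)
  have hg₂ := hg₁.of_isQuadraticCenter hI hc
  have hlt := hc.lt hb₁.1.2.1
  have hb₂ : ¬IsBasePoint I T₂ := fun hb₂ =>
    hlt.not_ge (hT₁.le_of_ge ⟨hb₂, hg₂, hTT₁.trans hlt.le, hT₂D⟩ hlt.le)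
  exact ⟨T₁, T₂, x, hb₁, hg₂, hc, hT₂D,
    hg₂.exists_extension_eq_span (hg₁.exists_mem_primeProducts hI hc) hb₂⟩

-- If `𝔭` were not maximal, the composite of the localization at `𝔭` with a suitable valuation ring
-- would dominate a point where `I` is principal, so that `I` would be principal at `𝔭`.
theorem IsGoodPoint.eq_maximalIdeal_of_mem_primeProducts (hI : I.radical = maximalIdeal R)
    (hfin : IsFinitelySupported K I) {T : LocalSubring K} (hT : IsGoodPoint I T)
    (hdim : 2 ≤ ringKrullDim T.toSubring) {m : T.toSubring} (hm : m ∈ primeProducts T.toSubring)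
    (hmI : m ∈ extension I T.toSubring) {J 𝔭 : Ideal T.toSubring} [h𝔭 : 𝔭.IsPrime]
    (hJ : IsTransform I T.toSubring J) (hJ𝔭 : J ≤ 𝔭) : 𝔭 = maximalIdeal T.toSubring := by
  have := hT.regular
  obtain ⟨a, J', ha, hleast, haJ, m', hm', hmJ⟩ := exists_isLeast_principal hm hmI
  obtain rfl := hJ.unique ⟨a, ha, hleast, haJ⟩
  have hbase : IsBasePoint I T := ⟨⟨hT.regular, hdim, hT.le, hT.chain⟩, J, hJ,
    fun h => h𝔭.ne_top (top_le_iff.1 (h ▸ hJ𝔭))⟩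
  by_contra hne
  obtain ⟨t, htm, ht𝔭⟩ := SetLike.exists_of_lt (lt_of_le_of_ne (le_maximalIdeal h𝔭.ne_top) hne)
  obtain ⟨W, hTD⟩ := exists_le_composite (LocalSubring.le_ofPrime T.toSubring 𝔭)
  obtain ⟨-, T₂, -, -, hg₂, -, hT₂D, z, hz⟩ :=
    exists_isQuadraticCenter_extension_eq_span hI hfin hT hbase hTD fun T' hg' _ hTT' hT'D => by
      have := hg'.regular
      exact maximalIdealBecomesPrincipal_composite
        (maximalIdeal T'.toSubring).fg_of_isNoetherianRing hT'D.1
        ((mem_maximalIdeal_iff_of_le hTT' t.2).1 htm)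
        (fun h => ne_zero_of_notMem ht𝔭 (congrArg Subtype.val h)) (inv_mem_ofPrime ht𝔭)
  exact extension_ofPrime_ne_span (algebraMap_mem_of_le hT.le) ha hleast haJ hJ𝔭 hm' hmJ _
    (extension_eq_span_of_le (hT₂D.1.trans composite_toSubring_le)
      (algebraMap_mem_of_le hg₂.le) hz)

theorem IsGoodPoint.eq_maximalIdeal_of_transform_le (hI : I.radical = maximalIdeal R)
    (hfin : IsFinitelySupported K I) {T : LocalSubring K} (hT : IsGoodPoint I T)
    (hdim : 2 ≤ ringKrullDim T.toSubring) {J 𝔭 : Ideal T.toSubring} [h𝔭 : 𝔭.IsPrime]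
    (hJ : IsTransform I T.toSubring J) (hJ𝔭 : J ≤ 𝔭) : 𝔭 = maximalIdeal T.toSubring := by
  rcases hT.primes with rfl | ⟨m, hm, hmI⟩
  · rw [hJ.unique (isTransform_extension_range hdim hI), ← h𝔭.radical_le_iff,
      radical_extension_range hI] at hJ𝔭
    exact le_antisymm (le_maximalIdeal h𝔭.ne_top) hJ𝔭
  · exact hT.eq_maximalIdeal_of_mem_primeProducts hI hfin hdim hm hmI hJ hJ𝔭

end Primary

section Avoidance

open Filter

theorem geom_sum₂_ne_zero_of_prime {F : Type*} [Field F] {u v : F} (h : u ≠ 0 ∨ v ≠ 0) {ℓ : ℕ}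
    (hℓ : ℓ.Prime) (hord : ℓ ≠ orderOf (u / v)) (hchar : ℓ ≠ ringChar F) :
    ∑ j ∈ Finset.range ℓ, u ^ j * v ^ (ℓ - 1 - j) ≠ 0 := by
  intro hsum
  by_cases huv : u = v
  · subst huv
    rw [geom_sum₂_self, mul_eq_zero, or_iff_left (pow_ne_zero _ (h.elim id id))] at hsum
    exact hchar (CharP.ringChar_of_prime_eq_zero hℓ hsum).symm
  · have hpow : u ^ ℓ = v ^ ℓ := by
      rw [← sub_eq_zero, ← (Commute.all u v).geom_sum₂_mul, hsum, zero_mul]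
    have hv : v ≠ 0 := by
      rintro rfl
      rw [zero_pow hℓ.ne_zero] at hpow
      exact huv (eq_zero_of_pow_eq_zero hpow)
    have : Fact ℓ.Prime := ⟨hℓ⟩
    refine hord (orderOf_eq_prime ?_ fun h1 => huv ((div_eq_one_iff_eq hv).1 h1)).symm
    rw [div_pow, hpow, div_self (pow_ne_zero _ hv)]

theorem eventually_isUnit_geom_sum₂ {B : Type*} [CommRing B] [IsLocalRing B] {u v : B}
    (h : IsUnit u ∨ IsUnit v) : ∀ᶠ ℓ : ℕ in atTop, ℓ.Prime →
      IsUnit (∑ j ∈ Finset.range ℓ, u ^ j * v ^ (ℓ - 1 - j)) := by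
  simp only [← residue_ne_zero_iff_isUnit, map_sum, map_mul, map_pow] at h ⊢
  filter_upwards [eventually_gt_atTop (orderOf (residue B u / residue B v)),
    eventually_gt_atTop (ringChar (ResidueField B))] with ℓ hord hchar hℓ
  exact geom_sum₂_ne_zero_of_prime h hℓ hord.ne' hchar.ne'

variable {K : Type*} [Field K]

theorem sum_div_pow_mul_div_pow (f g c : K) (ℓ : ℕ) :
    ∑ j ∈ Finset.range ℓ, (f / c) ^ j * (g / c) ^ (ℓ - 1 - j) =
      (∑ j ∈ Finset.range ℓ, f ^ j * g ^ (ℓ - 1 - j)) / c ^ (ℓ - 1) := by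
  rw [Finset.sum_div]
  refine Finset.sum_congr rfl fun j hj => ?_
  rw [div_pow, div_pow, div_mul_div_comm, ← pow_add,
    Nat.add_sub_cancel' (Nat.le_sub_one_of_lt (Finset.mem_range.1 hj))]

theorem eventually_div_geom_sum₂_mem {B : LocalSubring K} {f g c : K}
    (hf : f / c ∈ B.toSubring) (hg : g / c ∈ B.toSubring)
    (h : f / c ≠ 0 ∧ c / f ∈ B.toSubring ∨ g / c ≠ 0 ∧ c / g ∈ B.toSubring) :
    ∀ᶠ ℓ : ℕ in atTop, ℓ.Prime → ∑ j ∈ Finset.range ℓ, f ^ j * g ^ (ℓ - 1 - j) ≠ 0 ∧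
      c ^ (ℓ - 1) / ∑ j ∈ Finset.range ℓ, f ^ j * g ^ (ℓ - 1 - j) ∈ B.toSubring := by
  have hunit : IsUnit (⟨f / c, hf⟩ : B.toSubring) ∨ IsUnit (⟨g / c, hg⟩ : B.toSubring) :=
    h.imp (fun h => (isUnit_iff_inv_mem hf h.1).2 (inv_div f c ▸ h.2))
      fun h => (isUnit_iff_inv_mem hg h.1).2 (inv_div g c ▸ h.2)
  filter_upwards [eventually_isUnit_geom_sum₂ hunit] with ℓ hℓ hprime
  set w : B.toSubring := ∑ j ∈ Finset.range ℓ, ⟨f / c, hf⟩ ^ j * ⟨g / c, hg⟩ ^ (ℓ - 1 - j)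
    with hw
  have hwK : (w : K) = (∑ j ∈ Finset.range ℓ, f ^ j * g ^ (ℓ - 1 - j)) / c ^ (ℓ - 1) := by
    rw [← sum_div_pow_mul_div_pow, hw]
    simp only [AddSubmonoidClass.coe_finsetSum, Subring.coe_mul, Subring.coe_pow]
  have hw0 : (w : K) ≠ 0 := fun h0 => (hℓ hprime).ne_zero (Subtype.ext h0)
  have hinv := (isUnit_iff_inv_mem w.2 hw0).1 (hℓ hprime)
  rw [hwK, inv_div] at hinv
  exact ⟨(div_ne_zero_iff.1 (hwK ▸ hw0)).1, hinv⟩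

theorem geom_sum₂_mem_pow {A : Type*} [CommRing A] {L : Ideal A} {e ℓ : ℕ} {f g : A}
    (hf : f ∈ L ^ e) (hg : g ∈ L ^ e) :
    ∑ j ∈ Finset.range ℓ, f ^ j * g ^ (ℓ - 1 - j) ∈ L ^ (e * (ℓ - 1)) := by
  refine Ideal.sum_mem _ fun j hj => ?_
  rw [pow_mul, ← Nat.add_sub_cancel' (Nat.le_sub_one_of_lt (Finset.mem_range.1 hj)), pow_add,
    Nat.add_sub_cancel_left]
  exact Ideal.mul_mem_mul (Ideal.pow_mem_pow hf j) (Ideal.pow_mem_pow hg _)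

theorem eventually_pow_div_geom_sum₂_mem {T B : LocalSubring K} (hTB : T.toSubring ≤ B.toSubring)
    {x : T.toSubring} (hx0 : x ≠ 0) (hx : ∀ y ∈ maximalIdeal T.toSubring, (y : K) / x ∈ B.toSubring)
    {e : ℕ} {f g : T.toSubring} (hf : f ∈ maximalIdeal T.toSubring ^ e)
    (hg : g ∈ maximalIdeal T.toSubring ^ e)
    (h : f ≠ 0 ∧ (x : K) ^ e / f ∈ B.toSubring ∨ g ≠ 0 ∧ (x : K) ^ e / g ∈ B.toSubring) :
    ∀ᶠ ℓ : ℕ in atTop, ℓ.Prime → ∑ j ∈ Finset.range ℓ, f ^ j * g ^ (ℓ - 1 - j) ≠ 0 ∧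
      ∀ y ∈ maximalIdeal T.toSubring, (y : K) ^ (e * (ℓ - 1)) /
        (∑ j ∈ Finset.range ℓ, f ^ j * g ^ (ℓ - 1 - j) : T.toSubring) ∈ B.toSubring := by
  have hxK : (x : K) ≠ 0 := fun h => hx0 (Subtype.ext h)
  have hdiv : ∀ {f}, f ∈ maximalIdeal T.toSubring ^ e → (f : K) / (x : K) ^ e ∈ B.toSubring :=
    fun hf => algebraMap_div_pow_mem (fun a => hTB a.2) hx hf
  have hne : ∀ {f : T.toSubring}, f ≠ 0 → (f : K) / (x : K) ^ e ≠ 0 := fun hf =>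
    div_ne_zero (fun h => hf (Subtype.ext h)) (pow_ne_zero e hxK)
  filter_upwards [eventually_div_geom_sum₂_mem (hdiv hf) (hdiv hg)
    (h.imp (.imp_left hne) (.imp_left hne))] with ℓ hℓ hprime
  obtain ⟨hsum, hmem⟩ := hℓ hprime
  have hcoe : ((∑ j ∈ Finset.range ℓ, f ^ j * g ^ (ℓ - 1 - j) : T.toSubring) : K) =
      ∑ j ∈ Finset.range ℓ, (f : K) ^ j * (g : K) ^ (ℓ - 1 - j) := by
    simp only [AddSubmonoidClass.coe_finsetSum, Subring.coe_mul, Subring.coe_pow]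
  refine ⟨fun h => hsum (hcoe ▸ congrArg Subtype.val h), fun y hy => ?_⟩
  rw [hcoe]
  convert mul_mem (pow_mem (hx y hy) (e * (ℓ - 1))) hmem using 1
  rw [← pow_mul, div_pow, div_mul_div_cancel₀ (pow_ne_zero _ hxK)]

-- Homogeneous prime avoidance: `f` generates the extension of `𝔪 ^ e` to each `B ∈ s`. Since the
-- residue fields may be finite, `f` is a form `(f ^ ℓ - g ^ ℓ) / (f - g)` with a large prime `ℓ`,
-- whose linear factors are avoided by `ℓ` being different from finitely many orders.
theorem exists_mem_pow_forall_pow_div_mem {T : LocalSubring K}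
    (hT : maximalIdeal T.toSubring ≠ ⊥) {s : Set (LocalSubring K)} (hs : s.Finite)
    (hsT : ∀ B ∈ s, T.toSubring ≤ B.toSubring ∧ MaximalIdealBecomesPrincipal T B) :
    ∃ e ≠ 0, ∃ f ∈ maximalIdeal T.toSubring ^ e, f ≠ 0 ∧
      ∀ B ∈ s, ∀ y ∈ maximalIdeal T.toSubring, (y : K) ^ e / f ∈ B.toSubring := by
  induction s, hs using Set.Finite.induction_on with
  | empty =>
    obtain ⟨t, ht, ht0⟩ := Submodule.exists_mem_ne_zero_of_ne_bot hT
    exact ⟨1, one_ne_zero, t, by simpa only [pow_one], ht0, by simp⟩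
  | @insert B₀ s _ hs ih =>
    obtain ⟨e, he, f, hf, hf0, hfs⟩ := ih fun B hB => hsT B (Set.mem_insert_of_mem B₀ hB)
    obtain ⟨hTB₀, g, hg, hg0, hgdiv⟩ := hsT B₀ (Set.mem_insert B₀ s)
    have hge : g ^ e ∈ maximalIdeal T.toSubring ^ e := Ideal.pow_mem_pow hg e
    let h : ℕ → T.toSubring := fun ℓ =>
      ∑ j ∈ Finset.range ℓ, f ^ j * (g ^ e) ^ (ℓ - 1 - j)
    have key : ∀ B ∈ insert B₀ s, ∀ᶠ ℓ : ℕ in atTop, ℓ.Prime → h ℓ ≠ 0 ∧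
        ∀ y ∈ maximalIdeal T.toSubring, (y : K) ^ (e * (ℓ - 1)) / h ℓ ∈ B.toSubring := by
      rintro B (rfl | hB)
      · refine eventually_pow_div_geom_sum₂_mem hTB₀ hg0 hgdiv hf hge
          (Or.inr ⟨pow_ne_zero e hg0, ?_⟩)
        rw [Subring.coe_pow, div_self (pow_ne_zero e fun h => hg0 (Subtype.ext h))]
        exact one_mem _
      · obtain ⟨hTB, x, hx, hx0, hxdiv⟩ := hsT B (Set.mem_insert_of_mem B₀ hB)
        exact eventually_pow_div_geom_sum₂_mem hTB hx0 hxdiv hf hge (Or.inl ⟨hf0, hfs B hB x hx⟩)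
    obtain ⟨ℓ, hℓ, hℓB⟩ :=
      ((Nat.frequently_atTop_iff_infinite.2 Nat.infinite_setOfPred_prime).and_eventually
        ((eventually_all_finite (hs.insert B₀)).2 key)).exists
    exact ⟨e * (ℓ - 1), mul_ne_zero he (Nat.sub_pos_of_lt hℓ.one_lt).ne', h ℓ,
      geom_sum₂_mem_pow hf hge, (hℓB B₀ (Set.mem_insert B₀ s) hℓ).1, fun B hB => (hℓB B hB hℓ).2⟩

end Avoidance

section GreatestCommonDivisor

variable {A : Type*} [CommRing A] [UniqueFactorizationMonoid A]

theorem mem_primeProducts_of_ne_zero {a : A} (ha : a ≠ 0) : a ∈ primeProducts A := by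
  induction a using UniqueFactorizationMonoid.induction_on_prime with
  | h₁ => exact absurd rfl ha
  | h₂ u hu => exact mem_primeProducts_of_isUnit_or_prime (Or.inl hu)
  | h₃ a p ha0 hp ih =>
    exact mul_mem (mem_primeProducts_of_isUnit_or_prime (Or.inr hp)) (ih ha0)

variable [IsDomain A]

theorem exists_forall_le_span_iff_dvd {L : Ideal A} (hL : L ≠ ⊥) :
    ∃ b : A, ∀ q, L ≤ Ideal.span {q} ↔ q ∣ b := by
  obtain ⟨l, hl, hl0⟩ := Submodule.exists_mem_ne_zero_of_ne_bot hL
  obtain ⟨b, -, -, hleast, -⟩ := exists_isLeast_principal (mem_primeProducts_of_ne_zero hl0) hl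
  refine ⟨b, fun q => ⟨fun hq => ?_, fun hq => ?_⟩⟩
  · exact Ideal.span_singleton_le_span_singleton.1 (hleast.2 ⟨⟨⟨q, rfl⟩⟩, hq⟩)
  · exact hleast.1.2.trans (Ideal.span_singleton_le_span_singleton.2 hq)

-- Write `f = b ^ e * c` with `c` a nonunit, and let `p` be a prime factor of `c`. Some `y ∈ s` is
-- not divisible by `b * p`.
theorem exists_not_dvd_pow [IsLocalRing A] {s : Set A} {b : A}
    (hb : ∀ q, Ideal.span s ≤ Ideal.span {q} ↔ q ∣ b)
    (hs : Ideal.span s ≤ Ideal.span {b} * maximalIdeal A) {e : ℕ} (he : e ≠ 0) {f : A}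
    (hf : f ∈ Ideal.span s ^ e) (hf0 : f ≠ 0) : ∃ y ∈ s, ¬f ∣ y ^ e := by
  have hfe := Ideal.pow_right_mono hs e hf
  rw [mul_pow, Ideal.span_singleton_pow] at hfe
  obtain ⟨c, hc, rfl⟩ := Ideal.mem_span_singleton_mul.1 hfe
  have hbe := left_ne_zero_of_mul hf0
  obtain ⟨p, hp, hpc⟩ := WfDvdMonoid.exists_irreducible_factor
    ((mem_maximalIdeal c).1 (Ideal.pow_le_self he hc)) (right_ne_zero_of_mul hf0)
  obtain ⟨y, hy, hpy⟩ : ∃ y ∈ s, ¬b * p ∣ y := by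
    by_contra! h
    have hbp : b * p ∣ b * 1 := (mul_one b).symm ▸
      (hb _).1 (Ideal.span_le.2 fun y hy => Ideal.mem_span_singleton.2 (h y hy))
    exact hp.not_isUnit (isUnit_of_dvd_one
      ((mul_dvd_mul_iff_left (pow_ne_zero_iff he |>.1 hbe)).1 hbp))
  obtain ⟨d, rfl⟩ :=
    Ideal.mem_span_singleton.1 ((hb b).2 dvd_rfl (Ideal.subset_span hy))
  refine ⟨b * d, hy, fun hdvd => hpy (mul_dvd_mul_left b ?_)⟩
  rw [mul_pow, mul_dvd_mul_iff_left hbe] at hdvd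
  exact hp.prime.dvd_of_dvd_pow (hpc.trans hdvd)

end GreatestCommonDivisor

section Factorial

variable {R K : Type*} [CommRing R] [Field K] [Algebra R K] {I : Ideal R} {S T : LocalSubring K}

theorem IsTransform.exists_forall_dvd (hS : IsOnNormalizedBlowup I S)
    (hTS : T.toSubring ≤ S.toSubring) (hRT : ∀ r, algebraMap R K r ∈ T.toSubring)
    {J : Ideal T.toSubring} (hJ : IsTransform I T.toSubring J) :
    ∃ g ∈ J, g ≠ 0 ∧ ∀ j ∈ J, Subring.inclusion hTS g ∣ Subring.inclusion hTS j := by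
  obtain ⟨α, hα, hα0, hαS, -⟩ := hS.exists_generator
  obtain ⟨a, ha, -, haJ⟩ := hJ
  have hαT : (⟨_, hRT α⟩ : T.toSubring) ∈ Ideal.span {a} * J :=
    haJ ▸ Ideal.subset_span ⟨α, hα, rfl⟩
  obtain ⟨g, hg, hαg⟩ := Ideal.mem_span_singleton_mul.1 hαT
  have hag : (a : K) * g = algebraMap R K α := congrArg Subtype.val hαg
  have hext : extension I S.toSubring ≤ Ideal.span {Subring.inclusion hTS (a * g)} := by
    refine Ideal.span_le.2 ?_
    rintro s ⟨i, hi, his⟩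
    refine Ideal.mem_span_singleton.2 ⟨⟨_, hαS i hi⟩, Subtype.ext ?_⟩
    change (s : K) = a * g * (algebraMap R K i / algebraMap R K α)
    rw [his, hag, mul_div_cancel₀ _ hα0]
  refine ⟨g, hg, ?_, fun j hj => ?_⟩
  · rintro rfl
    exact hα0 (by rw [← hag, Subring.coe_zero, mul_zero])
  · have haj : Subring.inclusion hTS (a * j) ∈ extension I S.toSubring := by
      rw [← map_extension hTS hRT, ← haJ]
      exact Ideal.mem_map_of_mem _ (Ideal.mul_mem_mul (Ideal.mem_span_singleton_self a) hj)
    have hdvd := Ideal.mem_span_singleton.1 (hext haj)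
    rw [map_mul, map_mul] at hdvd
    exact (mul_dvd_mul_iff_left
      ((map_ne_zero_iff _ (Subring.inclusion_injective hTS)).2 ha)).1 hdvd

theorem map_maximalIdeal_le_mul (h : ¬MaximalIdealBecomesPrincipal T S)
    (hTS : T.toSubring ≤ S.toSubring) {b : S.toSubring}
    (hb : (maximalIdeal T.toSubring).map (Subring.inclusion hTS) ≤ Ideal.span {b}) :
    (maximalIdeal T.toSubring).map (Subring.inclusion hTS) ≤
      Ideal.span {b} * maximalIdeal S.toSubring := by
  refine Ideal.map_le_iff_le_comap.2 fun y hy => ?_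
  have hbdvd : ∀ z ∈ maximalIdeal T.toSubring, b ∣ Subring.inclusion hTS z := fun z hz =>
    Ideal.mem_span_singleton.1 (hb (Ideal.mem_map_of_mem _ hz))
  obtain ⟨c, hc⟩ := hbdvd y hy
  rcases eq_or_ne y 0 with rfl | hy0
  · exact Ideal.zero_mem _
  rw [Ideal.mem_comap, hc]
  refine Ideal.mul_mem_mul (Ideal.mem_span_singleton_self b) ((mem_maximalIdeal c).2 fun hcu => ?_)
  refine h ⟨y, hy, hy0, fun z hz => ?_⟩
  obtain ⟨w, hw⟩ := (Associated.dvd_iff_dvd_left ⟨hcu.unit, hc.symm⟩).1 (hbdvd z hz)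
  have hzw : (z : K) = y * w := congrArg Subtype.val hw
  rw [hzw, mul_div_cancel_left₀ _ fun h => hy0 (Subtype.ext h)]
  exact w.2

theorem IsQuadraticCenter.not_map_maximalIdeal_le_mul {T' : LocalSubring K} {x : T.toSubring}
    (h : IsQuadraticCenter T x T') (hTS : T.toSubring ≤ S.toSubring) (hST' : S ≤ T')
    {b : S.toSubring} (hb : b ∈ maximalIdeal S.toSubring) :
    ¬(maximalIdeal T.toSubring).map (Subring.inclusion hTS) ≤
      Ideal.span {b} * maximalIdeal S.toSubring := by
  intro hle
  obtain ⟨v, hv, hbv⟩ :=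
    Ideal.mem_span_singleton_mul.1 (hle (Ideal.mem_map_of_mem _ h.mem))
  have hxbv : Subring.inclusion h.transform.2.1 x =
      Subring.inclusion hST'.1 b * Subring.inclusion hST'.1 v := by
    rw [← map_mul, hbv]
    rfl
  have hloc := hST'.2
  rcases h.prime.irreducible.isUnit_or_isUnit hxbv with hu | hu
  · exact (mem_maximalIdeal b).1 hb (hloc.map_nonunit b hu)
  · exact (mem_maximalIdeal v).1 hv (hloc.map_nonunit v hu)

variable [IsRegularLocalRing R] [IsFractionRing R K]

theorem IsGoodPoint.exists_isQuadraticCenter_le (hI : I.radical = maximalIdeal R)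
    (hS : IsOnNormalizedBlowup I S) (hT : IsGoodPoint I T) (hTS : T ≤ S) {D : LocalSubring K}
    (hSD : S ≤ D) (hTD : MaximalIdealBecomesPrincipal T D)
    (hD : ∀ T' : LocalSubring K, T ≤ T' → MaximalIdealBecomesPrincipal T T' → T' ≤ D →
      ¬IsBasePoint I T') :
    ∃ (x : T.toSubring) (T' : LocalSubring K), IsQuadraticCenter T x T' ∧ S ≤ T' := by
  have := hT.regular
  obtain ⟨x, T', hc, hT'D⟩ := exists_isQuadraticCenter (hTS.trans hSD) hTD
  have hg := hT.of_isQuadraticCenter hI hc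
  have hx0 : x ≠ 0 :=
    (map_ne_zero_iff _ (Subring.inclusion_injective _)).1 hc.prime.ne_zero
  obtain ⟨z, hz⟩ := hg.exists_extension_eq_span (hT.exists_mem_primeProducts hI hc)
    (hD T' hc.transform.2 ⟨x, hc.mem, hx0, hc.div_mem⟩ hT'D)
  have := hg.regular
  exact ⟨x, T', hc, hS.le_of_extension_eq hSD hT'D (algebraMap_mem_of_le hg.le)
    (fun _ => mem_of_isIntegral_of_le hg.le) hz⟩

variable [UniqueFactorizationMonoid S.toSubring]

-- A prime factor in `S` of a generator of the extension of the transform of `I` in `T` contracts to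
-- a prime containing this transform, that is, to the maximal ideal of `T`.
theorem IsGoodPoint.exists_prime_map_le (hI : I.radical = maximalIdeal R)
    (hfin : IsFinitelySupported K I) (hS : IsOnNormalizedBlowup I S) (hT : IsGoodPoint I T)
    (hbase : IsBasePoint I T) (hTS : T ≤ S) :
    ∃ p : S.toSubring, Prime p ∧
      (maximalIdeal T.toSubring).map (Subring.inclusion hTS.1) ≤ Ideal.span {p} := by
  obtain ⟨J, hJ, hJ_ne⟩ := hbase.2
  obtain ⟨g, hg, hg0, hdvd⟩ :=
    hJ.exists_forall_dvd hS hTS.1 (algebraMap_mem_of_le hT.le)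
  have hgm := (mem_maximalIdeal_iff_of_le hTS g.2).1 (le_maximalIdeal hJ_ne hg)
  obtain ⟨p, hp, hpg⟩ := WfDvdMonoid.exists_irreducible_factor ((mem_maximalIdeal _).1 hgm)
    ((map_ne_zero_iff _ (Subring.inclusion_injective hTS.1)).2 hg0)
  have hprime : (Ideal.span {p}).IsPrime := (Ideal.span_singleton_prime hp.ne_zero).2 hp.prime
  have hJp : J ≤ (Ideal.span {p}).comap (Subring.inclusion hTS.1) := fun j hj =>
    Ideal.mem_span_singleton.2 (hpg.trans (hdvd j hj))
  exact ⟨p, hp.prime, Ideal.map_le_iff_le_comap.2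
    (hT.eq_maximalIdeal_of_transform_le hI hfin hbase.1.2.1 hJ hJp).ge⟩

-- Let `b` be the gcd in `S` of the maximal ideal `𝔪` of `T`. If `𝔪` does not become principal in
-- `S`, then its elements are multiples of `b` by nonunits of `S`, and there is a valuation ring
-- dominating `S` whose center on the blowup of `𝔪` is not a base point. This center dominates `S`,
-- and in it `𝔪` is generated by a prime element that is a product of two nonunits.
theorem IsGoodPoint.maximalIdealBecomesPrincipal (hI : I.radical = maximalIdeal R)
    (hfin : IsFinitelySupported K I) (hS : IsOnNormalizedBlowup I S) (hT : IsGoodPoint I T)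
    (hbase : IsBasePoint I T) (hTS : T ≤ S) : MaximalIdealBecomesPrincipal T S := by
  by_contra hno
  have := hT.regular
  have hm0 : maximalIdeal T.toSubring ≠ ⊥ := fun h => bot_ne_top
    (eq_top_of_isPrincipal_of_maximalIdeal_le_radical hbase.1.2.1 bot_isPrincipal
      (h.trans_le bot_le))
  set ι := Subring.inclusion hTS.1
  obtain ⟨b, hb⟩ := exists_forall_le_span_iff_dvd (L := (maximalIdeal T.toSubring).map ι) <|
    (Ideal.map_eq_bot_iff_of_injective (Subring.inclusion_injective hTS.1)).not.2 hm0
  have hle := map_maximalIdeal_le_mul hno hTS.1 ((hb b).2 dvd_rfl)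
  have hbm : b ∈ maximalIdeal S.toSubring := by
    obtain ⟨p, hp, hpm⟩ := hT.exists_prime_map_le hI hfin hS hbase hTS
    exact (mem_maximalIdeal b).2 fun hu => hp.not_isUnit (isUnit_of_dvd_unit ((hb p).1 hpm) hu)
  obtain ⟨e, he, f, hf, hf0, hfB⟩ := exists_mem_pow_forall_pow_div_mem hm0
    (hfin.subset (t := {B : LocalSubring K | IsBasePoint I B ∧ T.toSubring ≤ B.toSubring ∧
      MaximalIdealBecomesPrincipal T B}) fun _ h => h.1) fun _ h => h.2
  obtain ⟨_, ⟨y, hy, rfl⟩, hyf⟩ := exists_not_dvd_pow hb hle he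
    (Ideal.map_pow ι _ e ▸ Ideal.mem_map_of_mem ι hf)
    ((map_ne_zero_iff ι (Subring.inclusion_injective hTS.1)).2 hf0)
  have hyfS : (y : K) ^ e / f ∉ S.toSubring := fun h => hyf ⟨⟨_, h⟩, Subtype.ext
    (mul_div_cancel₀ ((y : K) ^ e) fun h => hf0 (Subtype.ext h)).symm⟩
  have := isFractionRing_of_le (hT.le.trans hTS)
  have : IsIntegrallyClosedIn S.toSubring K :=
    (isIntegrallyClosed_iff_isIntegrallyClosedIn K).1 inferInstance
  obtain ⟨V, hSV, hyfV⟩ := LocalSubring.exists_le_valuationSubring_of_isIntegrallyClosedIn hyfS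
  obtain ⟨x, T', hc, hST'⟩ := hT.exists_isQuadraticCenter_le hI hS hTS hSV
    (maximalIdealBecomesPrincipal_valuationSubring (maximalIdeal T.toSubring).fg_of_isNoetherianRing
      hm0 (hTS.1.trans hSV.1))
    fun T' hTT' hprin hT'V hb' => hyfV (hT'V.1 (hfB T' ⟨hb', hTT'.1, hprin⟩ y hy))
  exact hc.not_map_maximalIdeal_le_mul hTS.1 hST' hbm hle

end Factorial

end FinSupp

end

theorem theorem2p13 {R K : Type*} [CommRing R] [IsDomain R] [IsRegularLocalRing R]
    [Field K] [Algebra R K] [IsFractionRing R K] (hdim : 2 ≤ ringKrullDim R)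
    (I : Ideal R) (hI : I.radical = IsLocalRing.maximalIdeal R)
    (hfin : FinSupp.IsFinitelySupported K I)
    (S : LocalSubring K) (hS : FinSupp.IsOnNormalizedBlowup I S)
    (hdom : LocalSubring.range (algebraMap R K) ≤ S)
    (hUFD : UniqueFactorizationMonoid S.toSubring) :
    IsRegularLocalRing S.toSubring ∧
      ((∃ T : LocalSubring K, FinSupp.IsBasePoint I T ∧
          (S.toSubring : Set K) = FinSupp.ordValuationRing T) ∨
        FinSupp.IsInfinitelyNear (LocalSubring.range (algebraMap R K)) S) := by
  obtain ⟨T, T', x, hbase, hgood, hcen, hT'S, z, hz⟩ :=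
    FinSupp.exists_isQuadraticCenter_extension_eq_span hI hfin FinSupp.isGoodPoint_range
      (FinSupp.isBasePoint_range hdim hI) hdom fun T hT hbase _ hTS =>
        hT.maximalIdealBecomesPrincipal hI hfin hS hbase hTS
  have hreg := hgood.regular
  have hST' : S ≤ T' :=
    hS.le_of_extension_eq le_rfl hT'S (FinSupp.algebraMap_mem_of_le hgood.le)
      (fun _ => FinSupp.mem_of_isIntegral_of_le hgood.le) hz
  obtain rfl := le_antisymm hST' hT'S
  refine ⟨hreg, ?_⟩
  rcases lt_or_ge (ringKrullDim S.toSubring) 2 with h | h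
  · exact Or.inl ⟨T, hbase, hcen.eq_ord h⟩
  · exact Or.inr ⟨hreg, h, hgood.le, hgood.chain⟩
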